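/- All vector spaces are over $\mathbb{C}$. A vertex operator algebra is a $\mathbb{Z}$-graded space $V=\coprod_{n\in\mathbb{Z}}V_{(n)}$ with $\dim V_{(n)}<\infty$ and $V_{(n)}=0$ for $n$ sufficiently negative, together with a linear map $u\mapsto Y(u,x)=\sum_{n\in\mathbb{Z}}u(n)x^{-n-1}\in(\mathrm{End}\,V)[[x,x^{-1}]]$, a vacuum vector $\mathbf 1$ and a conformal vector $\omega$, satisfying the usual axioms: lower truncation, $Y(\mathbf 1,x)=\mathrm{id}_V$, the creation property, the Jacobi identity, the Virasoro relations for $L(n)=\omega(n+1)$ with some central charge, $L(0)v=nv$ for $v\in V_{(n)}$, and $Y(L(-1)u,x)=\frac{d}{dx}Y(u,x)$. It is of CFT type if $V_{(n)}=0$ for $n<0$ and $V_{(0)}=\mathbb{C}\mathbf 1$. It is $C_2$-cofinite if the span $C_2(V)$ of all $u(-2)v$, $u,v\in V$, has finite codimension in $V$. An automorphism of $V$ is an invertible linear map $g$ with $g\mathbf 1=\mathbf 1$, $g\omega=\omega$ and $gY(u,x)v=Y(gu,x)gv$. Write $g=e^{2\pi i\mathcal L}$ on $V$, where $\mathcal L$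 preserves each (finite-dimensional) $V_{(n)}$ and has Jordan decomposition $\mathcal L=\mathcal S+\mathcal N$ into commuting semisimple and locally nilpotent parts, the eigenvalues of $\mathcal S$ having real part in $[0,1)$. Let $P(V)$ be the set of eigenvalues of $\mathcal S$, let $V^{[\alpha]}$ be the $\alpha$-eigenspace of $\mathcal S$, and let $V_+=\coprod_{n>0}V_{(n)}$. A weak $g$-twisted $V$-module is a vector space $W$ with a linear map $V\to(\mathrm{End}\,W)\{x\}[\log x]$, $u\mapsto Y_W(u,x)=\sum_{k=0}^{K}\sum_{n\in\mathbb{C}}u(n,k)x^{-n-1}(\log x)^k$ (with $K$ depending on $u$), such that: 1. for all $u\in V$, $w\in W$, $n\in\mathbb{C}$, $k\ge 0$, one has $u(n+l,k)w=0$ for all sufficiently large integers $l$; 2. $Y_W(\mathbf 1,x)=\mathrm{id}_W$; 3. for all $u,v\in V$, $$x_0^{-1}\delta\Big(\tfrac{x_1-x_2}{x_0}\Big)Y_W(u,x_1)Y_W(v,x_2)-x_0^{-1}\delta\Big(\tfrac{-x_2+x_1}{x_0}\Big)Y_W(v,x_2)Y_W(u,x_1)=x_1^{-1}\delta\Big(\tfrac{x_2+x_0}{x_1}\Big)Y_W\Big(Y\Big(\Big(\tfrac{x_2+x_0}{x_1}\Big)^{\mathcal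 L}u,x_0\Big)v,x_2\Big);$$ 4. $Y_W(u,x)$ is obtained from $Y_W(gu,x)$ by replacing each $x^{n}$ by $e^{2\pi i n}x^{n}$ and $\log x$ by $\log x+2\pi i$. $W$ is finitely generated if there is a finite subset of $W$ such that the only subspace of $W$ containing it and stable under all modes $u(n,k)$ is $W$ itself. For an integer $n\ge1$, let $C_n(W)$ be the span of all $u(\alpha-n,0)w$ with $\alpha\in P(V)$, $u\in V^{[\alpha]}$, $w\in W$, where for $n=1$ one requires in addition $u\in V_+$. $W$ is $C_n$-cofinite if $\dim W/C_n(W)<\infty$. **Theorem.** Let $V$ be a $C_2$-cofinite vertex operator algebra of CFT type and let $g$ be any automorphism of $V$ (not assumed to be of finite order or semisimple). Then every finitely generated weak $g$-twisted $V$-module $W$ is $C_n$-cofinite for every integer $n\ge1$. -/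

import Mathlib

noncomputable section

open scoped Nat

/-- A vertex operator algebra over `ℂ` with underlying vector space `V`.
`VertexOperator.ncoeff (Y u) n` is the mode `u(n)` in `Y(u, x) = ∑ u(n) x^(-n-1)`; that `Y(u, x) v`
has only finitely many negative powers of `x` is part of the type `VertexOperator ℂ V`.
The Virasoro modes are `L(n) = ω(n+1)`, and the weight space `V_(n)` is the eigenspace of `L(0)`
with eigenvalue `n`. -/
structure VertexOperatorAlgebra (V : Type*) [AddCommGroup V] [Module ℂ V] where
  /-- the vertex operator map -/
  Y : V →ₗ[ℂ] VertexOperator ℂ V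
  /-- the vacuum vector -/
  vac : V
  /-- the conformal vector -/
  omega : V
  /-- the central charge -/
  charge : ℂ
  /-- `Y(1, x) = id` -/
  vacuum : ∀ (n : ℤ) (v : V), VertexOperator.ncoeff (Y vac) n v = if n = -1 then v else 0
  /-- `Y(u, x) 1` has no negative powers of `x` -/
  creation : ∀ (u : V) (n : ℤ), 0 ≤ n → VertexOperator.ncoeff (Y u) n vac = 0
  /-- the constant term of `Y(u, x) 1` is `u` -/
  creation_lim : ∀ u : V, VertexOperator.ncoeff (Y u) (-1) vac = u
  /-- The Jacobi identity: the coefficient of `x₀^(-l-1) x₁^(-m-1) x₂^(-n-1)`, applied to `w`. All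
  the sums are finite. -/
  jacobi : ∀ (u v w : V) (l m n : ℤ),
    (∑ᶠ i : ℕ, ((-1 : ℂ) ^ i * (Ring.choose l i : ℤ)) •
        VertexOperator.ncoeff (Y u) (m + l - i) (VertexOperator.ncoeff (Y v) (n + i) w)) -
      (∑ᶠ i : ℕ, ((-1 : ℂ) ^ (l + i) * (Ring.choose l i : ℤ)) •
        VertexOperator.ncoeff (Y v) (n + l - i) (VertexOperator.ncoeff (Y u) (m + i) w)) =
    ∑ᶠ i : ℕ, ((Ring.choose m i : ℤ) : ℂ) •
        VertexOperator.ncoeff (Y (VertexOperator.ncoeff (Y u) (l + i) v)) (m + n - i) w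
  /-- the Virasoro relations -/
  virasoro : ∀ (m n : ℤ) (v : V),
    VertexOperator.ncoeff (Y omega) (m + 1) (VertexOperator.ncoeff (Y omega) (n + 1) v) -
      VertexOperator.ncoeff (Y omega) (n + 1) (VertexOperator.ncoeff (Y omega) (m + 1) v) =
    ((m : ℂ) - n) • VertexOperator.ncoeff (Y omega) (m + n + 1) v +
      (if m + n = 0 then ((m : ℂ) ^ 3 - m) / 12 * charge else 0) • v
  /-- the `L(-1)`-derivative property `Y(L(-1)u, x) = d/dx Y(u, x)` -/
  derivative : ∀ (u : V) (n : ℤ),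
    VertexOperator.ncoeff (Y (VertexOperator.ncoeff (Y omega) 0 u)) n =
      (-(n : ℂ)) • VertexOperator.ncoeff (Y u) (n - 1)
  /-- `V` is the direct sum of the weight spaces `V_(n)`, `n ∈ ℤ` -/
  grading : DirectSum.IsInternal fun n : ℤ =>
    Module.End.eigenspace (VertexOperator.ncoeff (Y omega) 1) (n : ℂ)
  /-- the weight spaces are finite dimensional -/
  finite_weight : ∀ n : ℤ,
    FiniteDimensional ℂ (Module.End.eigenspace (VertexOperator.ncoeff (Y omega) 1) (n : ℂ))
  /-- the weight spaces of sufficiently negative weight vanish -/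
  lower_bound : ∃ N : ℤ, ∀ n : ℤ, n < N →
    Module.End.eigenspace (VertexOperator.ncoeff (Y omega) 1) (n : ℂ) = ⊥

namespace VertexOperatorAlgebra

variable {V : Type*} [AddCommGroup V] [Module ℂ V] (A : VertexOperatorAlgebra V)

/-- The mode `u(n)` of `Y(u, x) = ∑ u(n) x^(-n-1)`. -/
def mode (u : V) (n : ℤ) : Module.End ℂ V := VertexOperator.ncoeff (A.Y u) n

/-- The Virasoro mode `L(n) = ω(n+1)`. -/
def L (n : ℤ) : Module.End ℂ V := A.mode A.omega (n + 1)

/-- The weight space `V_(n)`. -/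
def weightSpace (n : ℤ) : Submodule ℂ V := Module.End.eigenspace (A.L 0) (n : ℂ)

/-- `V₊`, the sum of the weight spaces of positive weight. -/
def positivePart : Submodule ℂ V := ⨆ n : ℤ, ⨆ _ : 0 < n, A.weightSpace n

/-- `V` is of CFT type: `V_(n) = 0` for `n < 0` and `V_(0) = ℂ 1`. -/
def IsCFTType : Prop :=
  (∀ n : ℤ, n < 0 → A.weightSpace n = ⊥) ∧ A.weightSpace 0 = Submodule.span ℂ {A.vac}

/-- `C₂(V)`, spanned by the vectors `Res_x x⁻² Y(u, x) v = u(-2) v`. -/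
def C2 : Submodule ℂ V := Submodule.span ℂ {x | ∃ u v : V, x = A.mode u (-2) v}

/-- `V` is `C₂`-cofinite. -/
def IsC2Cofinite : Prop := FiniteDimensional ℂ (V ⧸ A.C2)

/-- An automorphism of a vertex operator algebra. -/
structure Automorphism where
  /-- the underlying invertible linear map -/
  toLinearEquiv : V ≃ₗ[ℂ] V
  map_vac : toLinearEquiv A.vac = A.vac
  map_omega : toLinearEquiv A.omega = A.omega
  map_mode : ∀ (u v : V) (n : ℤ),
    toLinearEquiv (A.mode u n v) = A.mode (toLinearEquiv u) n (toLinearEquiv v)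

/-- The unique `α` with `exp (2πi α) = μ` and `0 ≤ Re α < 1`, for `μ ≠ 0`. -/
def twistExponent (μ : ℂ) : ℂ :=
  Complex.log μ / (2 * Real.pi * Complex.I) -
    (⌊(Complex.log μ / (2 * Real.pi * Complex.I)).re⌋ : ℤ)

theorem exp_twistExponent {μ : ℂ} (hμ : μ ≠ 0) :
    Complex.exp (2 * Real.pi * Complex.I * twistExponent μ) = μ := by
  have h : (2 * Real.pi * Complex.I : ℂ) ≠ 0 := Complex.two_pi_I_ne_zero
  have : 2 * Real.pi * Complex.I * twistExponent μ = Complex.log μ -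
      (⌊(Complex.log μ / (2 * Real.pi * Complex.I)).re⌋ : ℤ) * (2 * Real.pi * Complex.I) := by
    unfold twistExponent
    field_simp
  rw [this, Complex.exp_sub, Complex.exp_int_mul_two_pi_mul_I, Complex.exp_log hμ, div_one]

theorem twistExponent_re_nonneg (μ : ℂ) : 0 ≤ (twistExponent μ).re := by
  simp only [twistExponent, Complex.sub_re, Complex.intCast_re]
  linarith [Int.floor_le (Complex.log μ / (2 * Real.pi * Complex.I)).re]

theorem twistExponent_re_lt_one (μ : ℂ) : (twistExponent μ).re < 1 := by
  simp only [twistExponent, Complex.sub_re, Complex.intCast_re]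
  linarith [Int.lt_floor_add_one (Complex.log μ / (2 * Real.pi * Complex.I)).re]

/-- The binomial coefficient `T (T - 1) ⋯ (T - j + 1) / j!` of a linear operator. -/
def opChoose (T : Module.End ℂ V) (j : ℕ) : Module.End ℂ V :=
  ((j ! : ℂ))⁻¹ • Polynomial.aeval T (descPochhammer ℂ j)

namespace Automorphism

variable {A} (g : A.Automorphism)

/-- The automorphism as a linear operator on `V`. -/
def toEnd : Module.End ℂ V := g.toLinearEquiv.toLinearMap

/-- The generalized eigenspace of `g` with eigenvalue `μ`. -/
def genSpace (μ : ℂ) : Submodule ℂ V := Module.End.maxGenEigenspace g.toEnd μ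

theorem toEnd_mem_weightSpace (n : ℤ) {v : V} (hv : v ∈ A.weightSpace n) :
    g.toEnd v ∈ A.weightSpace n := by
  rw [weightSpace, Module.End.mem_eigenspace_iff] at hv ⊢
  have h := g.map_mode A.omega v (0 + 1)
  rw [g.map_omega] at h
  change A.mode A.omega (0 + 1) (g.toLinearEquiv v) = (n : ℂ) • g.toLinearEquiv v
  rw [← h]
  change g.toLinearEquiv (A.L 0 v) = _
  rw [hv, map_smul]

theorem iSup_genSpace : ⨆ μ, g.genSpace μ = ⊤ := by
  rw [eq_top_iff]
  have hgr : ⨆ n : ℤ, A.weightSpace n = ⊤ := A.grading.submodule_iSup_eq_top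
  rw [← hgr]
  refine iSup_le fun n => ?_
  have hfin : FiniteDimensional ℂ (A.weightSpace n) := A.finite_weight n
  have hmaps : ∀ x ∈ A.weightSpace n, g.toEnd x ∈ A.weightSpace n :=
    fun x hx => g.toEnd_mem_weightSpace n hx
  have htop := Module.End.iSup_maxGenEigenspace_eq_top (g.toEnd.restrict hmaps)
  have hle : Submodule.map (A.weightSpace n).subtype ⊤ ≤ ⨆ μ, g.genSpace μ := by
    rw [← htop, Submodule.map_iSup]
    refine iSup_mono fun μ => ?_
    rintro _ ⟨x, hx, rfl⟩
    rw [SetLike.mem_coe, Module.End.mem_maxGenEigenspace] at hx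
    obtain ⟨k, hk⟩ := hx
    rw [genSpace, Module.End.mem_maxGenEigenspace]
    refine ⟨k, ?_⟩
    have key : ∀ (j : ℕ) (y : A.weightSpace n),
        (((g.toEnd.restrict hmaps - μ • 1) ^ j) y : V) = ((g.toEnd - μ • 1) ^ j) (y : V) := by
      intro j
      induction j with
      | zero => intro y; simp
      | succ j ih => intro y; rw [pow_succ, pow_succ, Module.End.mul_apply, ih]; simp
    rw [Submodule.subtype_apply, ← key, hk, Submodule.coe_zero]
  simpa using hle

theorem isInternal_genSpace : DirectSum.IsInternal g.genSpace :=
  DirectSum.isInternal_submodule_of_iSupIndep_of_iSup_eq_top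
    (Module.End.independent_maxGenEigenspace g.toEnd) g.iSup_genSpace

theorem bijective_coeLinearMap : Function.Bijective (DirectSum.coeLinearMap g.genSpace) :=
  g.isInternal_genSpace

/-- The decomposition of `V` into the generalized eigenspaces of `g`. -/
def decomposition : (DirectSum ℂ fun μ => g.genSpace μ) ≃ₗ[ℂ] V :=
  LinearEquiv.ofBijective (DirectSum.coeLinearMap g.genSpace) g.bijective_coeLinearMap

/-- The linear operator on `V` that is given by `f μ` on the generalized eigenspace of `g` with
eigenvalue `μ`. -/
def ofGenSpaces (f : ∀ μ : ℂ, g.genSpace μ →ₗ[ℂ] V) : Module.End ℂ V :=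
  DirectSum.toModule ℂ ℂ V f ∘ₗ g.decomposition.symm.toLinearMap

theorem ofGenSpaces_apply (f : ∀ μ : ℂ, g.genSpace μ →ₗ[ℂ] V) {μ : ℂ} (v : g.genSpace μ) :
    g.ofGenSpaces f v = f μ v := by
  have h : g.decomposition.symm (v : V) =
      DirectSum.lof ℂ ℂ (fun μ => g.genSpace μ) μ v := by
    rw [LinearEquiv.symm_apply_eq]
    exact (DirectSum.coeLinearMap_lof _ _ _).symm
  simp only [ofGenSpaces, LinearMap.comp_apply, LinearEquiv.coe_coe]
  rw [h, DirectSum.toModule_lof]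

/-- The semisimple operator `𝓢`: multiplication by the `α` with `exp (2πi α) = μ` and
`0 ≤ Re α < 1` on the generalized eigenspace of `g` with eigenvalue `μ`. -/
def opS : Module.End ℂ V :=
  g.ofGenSpaces fun μ => twistExponent μ • (g.genSpace μ).subtype

theorem finite_support_log (μ : ℂ) (v : g.genSpace μ) :
    (Function.support fun k : ℕ => ((-1 : ℂ) ^ k / (k + 1)) •
      ((μ⁻¹ • (g.toEnd - μ • 1)) ^ (k + 1)) (v : V)).Finite := by
  obtain ⟨N, hN⟩ := (Module.End.mem_maxGenEigenspace g.toEnd μ v).1 v.2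
  refine (Set.finite_lt_nat N).subset fun k hk => ?_
  by_contra hlt
  have hle : N ≤ k + 1 := by simp only [Set.mem_ofPred_eq] at hlt; omega
  apply hk
  have h0 : ((g.toEnd - μ • 1) ^ (k + 1)) (v : V) = 0 := by
    rw [← Nat.sub_add_cancel hle, pow_add, Module.End.mul_apply, hN, map_zero]
  simp only [smul_pow, LinearMap.smul_apply, h0, smul_zero]

/-- The logarithm `∑_{k ≥ 1} (-1)^(k-1) (μ⁻¹ g - 1)^k / k` of the unipotent operator `μ⁻¹ g` on the
generalized eigenspace of `g` with eigenvalue `μ`. -/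
def logOnGenSpace (μ : ℂ) : g.genSpace μ →ₗ[ℂ] V where
  toFun v := ∑ᶠ k : ℕ, ((-1 : ℂ) ^ k / (k + 1)) • ((μ⁻¹ • (g.toEnd - μ • 1)) ^ (k + 1)) (v : V)
  map_add' v w := by
    rw [← finsum_add_distrib (g.finite_support_log μ v) (g.finite_support_log μ w)]
    simp only [Submodule.coe_add, map_add, smul_add]
  map_smul' c v := by
    rw [RingHom.id_apply, smul_finsum' c (g.finite_support_log μ v)]
    refine finsum_congr fun k => ?_
    rw [Submodule.coe_smul, map_smul, smul_comm]

/-- The locally nilpotent operator `𝓝`, the logarithm of the unipotent part of `g` divided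
by `2πi`. -/
def opN : Module.End ℂ V :=
  (2 * Real.pi * Complex.I : ℂ)⁻¹ • g.ofGenSpaces g.logOnGenSpace

/-- The operator `𝓛 = 𝓢 + 𝓝`, for which `g = exp (2πi 𝓛)`. -/
def opL : Module.End ℂ V := g.opS + g.opN

/-- `P(V)`, the set of eigenvalues of `𝓢`. -/
def exponents : Set ℂ := {α | g.opS.HasEigenvalue α}

/-- `V^[α]`, the eigenspace of `𝓢` with eigenvalue `α`. -/
def component (α : ℂ) : Submodule ℂ V := Module.End.eigenspace g.opS α

end Automorphism

/-- A weak `g`-twisted module with underlying vector space `W`. -/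
structure WeakTwistedModule (g : A.Automorphism) (W : Type*) [AddCommGroup W] [Module ℂ W] where
  /-- `mode u n k` is `u(n, k)` in `Y_W(u, x) = ∑_k ∑_n u(n, k) x^(-n-1) (log x)^k` -/
  mode : V →ₗ[ℂ] ℂ → ℕ → Module.End ℂ W
  /-- `Y_W(u, x)` is a polynomial in `log x` -/
  log_bound : ∀ u : V, ∃ K : ℕ, ∀ (n : ℂ) (k : ℕ), K < k → mode u n k = 0
  /-- the lower truncation property -/
  lower_truncation : ∀ (u : V) (w : W) (n : ℂ) (k : ℕ),
    ∃ N : ℤ, ∀ l : ℤ, N ≤ l → mode u (n + l) k w = 0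
  /-- `Y_W(1, x) = id` -/
  identity : ∀ (n : ℂ) (k : ℕ) (w : W),
    mode A.vac n k w = if n = -1 ∧ k = 0 then w else 0
  /-- The Jacobi identity
  `x₀⁻¹ δ((x₁ - x₂)/x₀) Y_W(u, x₁) Y_W(v, x₂) - x₀⁻¹ δ((-x₂ + x₁)/x₀) Y_W(v, x₂) Y_W(u, x₁)
    = x₁⁻¹ δ((x₂ + x₀)/x₁) Y_W(Y(((x₂ + x₀)/x₁)^𝓛 u, x₀) v, x₂)`:
  the coefficient of `x₀^(-l-1) x₁^(-m-1) x₂^(-n-1) (log x₁)^k (log x₂)^h`, applied to `w`. All the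
  sums are finite. By linearity in `u` it suffices to let `u` run through the subspaces `V^[α]`,
  on which the right-hand side is
  `∑_{r ∈ ℤ} x₁^(-α-r-1) x₂^(α+r)
    Y_W(Y((1 + x₀/x₂)^(r+𝓛) exp(𝓝 log x₂) exp(-𝓝 log x₁) u, x₀) v, x₂)`. -/
  jacobi : ∀ (α : ℂ) (u v : V) (w : W), u ∈ g.component α →
    ∀ (l r : ℤ) (m n : ℂ) (k h : ℕ), m = α + r →
      (∑ᶠ i : ℕ, ((-1 : ℂ) ^ i * (Ring.choose l i : ℤ)) •
          mode u (m + l - i) k (mode v (n + i) h w)) -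
        (∑ᶠ i : ℕ, ((-1 : ℂ) ^ (l + i) * (Ring.choose l i : ℤ)) •
          mode v (n + l - i) h (mode u (m + i) k w)) =
      ∑ᶠ j : ℕ, ∑ a ∈ Finset.range (h + 1), ((-1 : ℂ) ^ k / ((k ! : ℂ) * (a ! : ℂ))) •
          mode (A.mode (opChoose ((r : ℂ) • 1 + g.opL) j ((g.opN ^ (a + k)) u)) (l + j) v)
            (m + n - j) (h - a) w
  /-- The same identity for the remaining powers of `x₁`, which do not occur on the right. -/
  jacobi_of_ne : ∀ (α : ℂ) (u v : V) (w : W), u ∈ g.component α →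
    ∀ (l : ℤ) (m n : ℂ) (k h : ℕ), (∀ r : ℤ, m ≠ α + r) →
      (∑ᶠ i : ℕ, ((-1 : ℂ) ^ i * (Ring.choose l i : ℤ)) •
          mode u (m + l - i) k (mode v (n + i) h w)) -
        (∑ᶠ i : ℕ, ((-1 : ℂ) ^ (l + i) * (Ring.choose l i : ℤ)) •
          mode v (n + l - i) h (mode u (m + i) k w)) = 0
  /-- The equivariance property `e^(2πi x d/dx) Y_W(gu, x) = Y_W(u, x)`, where the operator on the
  left replaces `x^(-n-1)` by `e^(2πi(-n-1)) x^(-n-1)` and `log x` by `log x + 2πi`: the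
  coefficient of `x^(-n-1) (log x)^k`. -/
  equivariance : ∀ (u : V) (n : ℂ) (k : ℕ) (w : W),
    ∑ᶠ j : ℕ, (Complex.exp (2 * Real.pi * Complex.I * (-n - 1)) * (j.choose k : ℂ) *
        (2 * Real.pi * Complex.I) ^ (j - k)) • mode (g.toEnd u) n j w = mode u n k w

namespace WeakTwistedModule

variable {A} {g : A.Automorphism} {W : Type*} [AddCommGroup W] [Module ℂ W]
  (M : A.WeakTwistedModule g W)

/-- `W` is generated by finitely many vectors: a finite subset of `W` is contained in no proper
subspace that is stable under all modes `u(n, k)`. -/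
def IsFinitelyGenerated : Prop :=
  ∃ s : Finset W, ∀ p : Submodule ℂ W, (∀ w ∈ s, w ∈ p) →
    (∀ (u : V) (n : ℂ) (k : ℕ) (w : W), w ∈ p → M.mode u n k w ∈ p) → p = ⊤

/-- `C_n(W)`, spanned by the vectors `u(α - n, 0) w` for `α ∈ P(V)`, `u ∈ V^[α]` and `w ∈ W`,
where `u ∈ V₊` is required if `n = 1`. -/
def C (n : ℕ) : Submodule ℂ W :=
  Submodule.span ℂ {x | ∃ α ∈ g.exponents, ∃ u ∈ g.component α, ∃ w : W,
    (n = 1 → u ∈ A.positivePart) ∧ x = M.mode u (α - n) 0 w}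

/-- `W` is `C_n`-cofinite. -/
def IsCofinite (n : ℕ) : Prop := FiniteDimensional ℂ (W ⧸ M.C n)

end WeakTwistedModule

end VertexOperatorAlgebra

end

noncomputable section

open scoped Nat IsMulCommutative

/-! Fix a finite generating set `s` and let `F_p` (`filt`) be spanned by products of modes `u(n, 0)`
of homogeneous vectors of positive weight, of total weight at most `p`, applied to elements of `s`.
By CFT type, a mode of a vector of weight `q` raises the filtration by at most `q`. The Jacobi
identity shows three things. Commutators of modes lose one degree (`commutator_mem_opFilt`). Modes
of `u(-2)v` lose one degree (`mode_mem_opFilt_of_homC2`). Modes of `u(-1)v` are convolutions of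
those of `u` and `v`, up to lower degree (`mode_neg_one_sub_mem_opFilt`).

On the associated graded space the modes therefore generate a commutative algebra, and `u(-1)^j 1`
acts through the `j`-th convolution power of the sequence of modes of `u`. By `C₂`-cofiniteness all
vectors of large weight lie in `C₂(V)`, so for `u` of positive weight some convolution power
vanishes. Since a high mode of `u` kills the finitely many generators, it acts as zero on the graded
space; hence the sequence has a top term, and every mode is nilpotent (`isNilpotent_of_convolution`,
`exists_pow_mode_mem_opFilt`).

Modulo lower degree and `C_n(W)` only finitely many modes matter (`exists_finite_modes`): large
weights lie in `C₂(V)`, high indices lower the degree, and sufficiently negative indices have image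
in `C_n(W)`. A word of large total weight in these modes repeats one of them so often that its
degree drops. Induction on the degree then gives `W = C_n(W) + D`, where `D` is spanned by words of
bounded weight and is finite dimensional. -/

theorem finsum_mem_submodule {ι W : Type*} [AddCommGroup W] [Module ℂ W] (X : Submodule ℂ W)
    {f : ι → W} (h : ∀ i, f i ∈ X) : ∑ᶠ i, f i ∈ X :=
  finsum_induction (· ∈ X) X.zero_mem (fun _ _ => X.add_mem) h

/-- The vanishing bound `N` may depend on the vector to which operators are applied, while `I` does
not. This is what turns vectorwise finite sums into operator identities modulo lower degree. -/
theorem finsum_sub_sum_range_mem {W : Type*} [AddCommGroup W] [Module ℂ W] (X : Submodule ℂ W)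
    {f : ℕ → W} (N I : ℕ) (hf : ∀ i, N ≤ i → f i = 0) (h : ∀ i, I ≤ i → f i ∈ X) :
    ∑ᶠ i, f i - ∑ i ∈ Finset.range I, f i ∈ X := by
  have h1 : ∑ᶠ i, f i = ∑ i ∈ Finset.range (I + N), f i := by
    refine finsum_eq_sum_of_support_subset _ fun i hi => ?_
    by_contra hlt
    exact hi (hf i (by simp only [Finset.coe_range, Set.mem_Iio] at hlt; omega))
  rw [h1, Finset.sum_range_add, add_sub_cancel_left]
  exact X.sum_mem fun i _ => h _ (by omega)

theorem Ring.choose_neg_one_int (i : ℕ) : Ring.choose (-1 : ℤ) i = (-1) ^ i := by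
  induction i with
  | zero => simp
  | succ i ih =>
    have h := Ring.choose_succ_succ (-1 : ℤ) i
    rw [neg_add_cancel, Ring.choose_zero_succ, ih] at h
    rw [pow_succ]; linarith

/-! ### Weights, generalized eigenspaces of `g`, and `C₂(V)` in large weight -/

namespace VertexOperatorAlgebra

variable {V : Type*} [AddCommGroup V] [Module ℂ V] {A : VertexOperatorAlgebra V}

theorem mem_weightSpace {n : ℤ} {v : V} : v ∈ A.weightSpace n ↔ A.L 0 v = (n : ℂ) • v :=
  Module.End.mem_eigenspace_iff

/-- The Jacobi identity for `ω` and `u` with `l = 0`, `m = 1` gives the commutator as modes of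
`L(-1)u` and `L(0)u`; the derivative property rewrites the former. -/
theorem L_zero_mode (u v : V) (n : ℤ) :
    A.L 0 (A.mode u n v) =
      A.mode u n (A.L 0 v) + A.mode (A.L 0 u) n v - ((n : ℂ) + 1) • A.mode u n v := by
  have h : (∑ᶠ i : ℕ, ((-1 : ℂ) ^ i * (Ring.choose (0 : ℤ) i : ℤ)) •
        A.mode A.omega (1 + 0 - i) (A.mode u (n + i) v)) -
      (∑ᶠ i : ℕ, ((-1 : ℂ) ^ ((0 : ℤ) + i) * (Ring.choose (0 : ℤ) i : ℤ)) •
        A.mode u (n + 0 - i) (A.mode A.omega (1 + i) v)) =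
    ∑ᶠ i : ℕ, ((Ring.choose (1 : ℤ) i : ℤ) : ℂ) •
        A.mode (A.mode A.omega (0 + i) u) (1 + n - i) v := A.jacobi A.omega u v 0 1 n
  have hd : A.mode (A.mode A.omega 0 u) (n + 1) = (-((n + 1 : ℤ) : ℂ)) • A.mode u (n + 1 - 1) :=
    A.derivative u (n + 1)
  rw [finsum_eq_single _ 0, finsum_eq_single _ 0,
    finsum_eq_sum_of_support_subset (s := Finset.range 2)] at h
  · simp only [Finset.sum_range_succ, Finset.sum_range_zero, Ring.choose_zero_right,
      Ring.choose_one_right] at h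
    simp only [Nat.cast_zero, Nat.cast_one, add_zero, sub_zero, pow_zero, zpow_zero, zero_add,
      Int.cast_one, one_smul, mul_one, add_sub_cancel_left] at h
    rw [add_comm 1 n, hd] at h
    simp only [add_sub_cancel_right, LinearMap.smul_apply] at h
    change A.mode A.omega (0 + 1) _ = A.mode u n (A.mode A.omega (0 + 1) v) +
      A.mode (A.mode A.omega (0 + 1) u) n v - _
    rw [zero_add]
    rw [sub_eq_iff_eq_add] at h
    rw [h]
    push_cast
    rw [neg_smul]
    abel
  · intro i hi
    by_contra hlt
    apply hi
    have : Ring.choose (1 : ℤ) i = 0 := by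
      have := Ring.choose_natCast (R := ℤ) 1 i
      rw [Nat.cast_one] at this
      rw [this, Nat.choose_eq_zero_of_lt (by simp at hlt; omega)]; simp
    simp [this]
  · intro i hi
    simp [Ring.choose_zero_pos ℤ (Nat.pos_of_ne_zero hi)]
  · intro i hi
    simp [Ring.choose_zero_pos ℤ (Nat.pos_of_ne_zero hi)]

theorem mode_add (u v : V) (n : ℤ) : A.mode (u + v) n = A.mode u n + A.mode v n := by
  simp [mode]

theorem mode_smul (c : ℂ) (u : V) (n : ℤ) : A.mode (c • u) n = c • A.mode u n := by
  simp [mode]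

theorem mode_sub (u v : V) (n : ℤ) : A.mode (u - v) n = A.mode u n - A.mode v n := by
  simp [mode]

theorem mode_zero (n : ℤ) : A.mode 0 n = 0 := by
  simp [mode]

theorem mode_mem_weightSpace {a b : ℤ} {u v : V} (hu : u ∈ A.weightSpace a)
    (hv : v ∈ A.weightSpace b) (n : ℤ) : A.mode u n v ∈ A.weightSpace (a + b - n - 1) := by
  rw [mem_weightSpace] at hu hv ⊢
  rw [L_zero_mode, hu, hv, map_smul, mode_smul, LinearMap.smul_apply, ← add_smul, ← sub_smul]
  congr 1
  push_cast
  ring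

theorem vac_mem_weightSpace : A.vac ∈ A.weightSpace 0 := by
  rw [mem_weightSpace, Int.cast_zero, zero_smul]
  exact A.creation A.omega (0 + 1) (by norm_num)

theorem aeval_mem {X : Submodule ℂ V} {T : Module.End ℂ V} (hT : ∀ x ∈ X, T x ∈ X)
    (p : Polynomial ℂ) {x : V} (hx : x ∈ X) : Polynomial.aeval T p x ∈ X := by
  induction p using Polynomial.induction_on' with
  | add p q hp hq => rw [map_add]; exact X.add_mem hp hq
  | monomial n c =>
    rw [Polynomial.aeval_monomial, ← Algebra.smul_def, LinearMap.smul_apply]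
    refine X.smul_mem _ ?_
    induction n with
    | zero => simpa
    | succ n ih => rw [pow_succ', Module.End.mul_apply]; exact hT _ ih

theorem opChoose_mem {X : Submodule ℂ V} {T : Module.End ℂ V} (hT : ∀ x ∈ X, T x ∈ X)
    (j : ℕ) {x : V} (hx : x ∈ X) : opChoose T j x ∈ X :=
  X.smul_mem _ (aeval_mem hT _ hx)

theorem opChoose_zero (T : Module.End ℂ V) : opChoose T 0 = 1 := by
  simp [opChoose]

theorem opChoose_one (T : Module.End ℂ V) : opChoose T 1 = T := by
  simp [opChoose]

theorem exists_forall_mem_iSup_ne (t : Finset V) :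
    ∃ q₀ : ℤ, ∀ q, q₀ ≤ q → ∀ x ∈ t, x ∈ ⨆ (i : ℤ) (_ : i ≠ q), A.weightSpace i := by
  have key : ∀ x : V, ∃ q₀ : ℤ, ∀ q, q₀ ≤ q → x ∈ ⨆ (i : ℤ) (_ : i ≠ q), A.weightSpace i := by
    intro x
    have hx : x ∈ ⨆ n : ℤ, A.weightSpace n := by
      have : ⨆ n : ℤ, A.weightSpace n = ⊤ := A.grading.submodule_iSup_eq_top
      rw [this]; trivial
    refine Submodule.iSup_induction _ (motive := fun x => ∃ q₀ : ℤ, ∀ q, q₀ ≤ q →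
      x ∈ ⨆ (i : ℤ) (_ : i ≠ q), A.weightSpace i) hx (fun i u hu => ?_)
      ⟨0, fun _ _ => zero_mem _⟩ ?_
    · exact ⟨i + 1, fun q hq => Submodule.mem_iSup_of_mem i
        (Submodule.mem_iSup_of_mem (by omega) hu)⟩
    · rintro x y ⟨a, ha⟩ ⟨b, hb⟩
      exact ⟨max a b, fun q hq => add_mem (ha q (le_of_max_le_left hq))
        (hb q (le_of_max_le_right hq))⟩
  choose f hf using key
  obtain ⟨M, hM⟩ := (t.image f).bddAbove
  exact ⟨M, fun q hq x hx => hf x q ((hM (Finset.mem_image_of_mem f hx)).trans hq)⟩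

namespace Automorphism

variable (g : A.Automorphism)

/-- Each weight space is finite dimensional and `g`-stable, so it splits into generalized
eigenspaces of the restriction of `g`. Weight and eigenvalue can thus be made homogeneous
simultaneously. -/
theorem weightSpace_le_iSup (n : ℤ) :
    A.weightSpace n ≤ ⨆ μ, A.weightSpace n ⊓ g.genSpace μ := by
  have hfin : FiniteDimensional ℂ (A.weightSpace n) := A.finite_weight n
  have hmaps : ∀ x ∈ A.weightSpace n, g.toEnd x ∈ A.weightSpace n :=
    fun x hx => g.toEnd_mem_weightSpace n hx
  have htop := Module.End.iSup_maxGenEigenspace_eq_top (g.toEnd.restrict hmaps)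
  have hle : Submodule.map (A.weightSpace n).subtype ⊤ ≤
      ⨆ μ, A.weightSpace n ⊓ g.genSpace μ := by
    rw [← htop, Submodule.map_iSup]
    refine iSup_mono fun μ => ?_
    rintro _ ⟨x, hx, rfl⟩
    refine ⟨x.2, ?_⟩
    rw [SetLike.mem_coe, Module.End.mem_maxGenEigenspace] at hx
    obtain ⟨k, hk⟩ := hx
    refine (Module.End.mem_maxGenEigenspace _ _ _).2 ⟨k, ?_⟩
    have key : ∀ (j : ℕ) (y : A.weightSpace n),
        (((g.toEnd.restrict hmaps - μ • 1) ^ j) y : V) = ((g.toEnd - μ • 1) ^ j) (y : V) := by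
      intro j
      induction j with
      | zero => intro y; simp
      | succ j ih => intro y; rw [pow_succ, pow_succ, Module.End.mul_apply, ih]; simp
    rw [Submodule.subtype_apply, ← key, hk, Submodule.coe_zero]
  simpa using hle

theorem opS_apply {μ : ℂ} {v : V} (hv : v ∈ g.genSpace μ) :
    g.opS v = twistExponent μ • v :=
  g.ofGenSpaces_apply (fun μ => twistExponent μ • (g.genSpace μ).subtype) ⟨v, hv⟩

theorem genSpace_le_component (μ : ℂ) : g.genSpace μ ≤ g.component (twistExponent μ) :=
  fun _ hv => Module.End.mem_eigenspace_iff.2 (g.opS_apply hv)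

theorem opN_apply {μ : ℂ} {v : V} (hv : v ∈ g.genSpace μ) :
    g.opN v = (2 * Real.pi * Complex.I : ℂ)⁻¹ • ∑ᶠ k : ℕ, ((-1 : ℂ) ^ k / (k + 1)) •
      ((μ⁻¹ • (g.toEnd - μ • 1)) ^ (k + 1)) v := by
  rw [opN, LinearMap.smul_apply]
  congr 1
  exact g.ofGenSpaces_apply g.logOnGenSpace ⟨v, hv⟩

/-- `𝓝 v` lies in every subspace that contains the `(g - μ)^k v`, `k ≥ 1`. -/
theorem opN_mem {X : Submodule ℂ V} {μ : ℂ} {v : V} (hv : v ∈ g.genSpace μ)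
    (hX : ∀ k : ℕ, ((g.toEnd - μ • 1) ^ (k + 1)) v ∈ X) : g.opN v ∈ X := by
  rw [opN_apply g hv]
  refine X.smul_mem _ (finsum_mem_submodule X fun k => X.smul_mem _ ?_)
  rw [smul_pow, LinearMap.smul_apply]
  exact X.smul_mem _ (hX k)

theorem sub_pow_mem {X : Submodule ℂ V} {μ : ℂ} (hX : ∀ x ∈ X, g.toEnd x ∈ X) (k : ℕ) {v : V}
    (hv : v ∈ X) : ((g.toEnd - μ • 1) ^ k) v ∈ X := by
  induction k with
  | zero => simpa
  | succ k ih =>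
    rw [pow_succ', Module.End.mul_apply]
    simpa using X.sub_mem (hX _ ih) (X.smul_mem μ ih)

theorem opN_mem_weightSpace {n : ℤ} {v : V} (hv : v ∈ A.weightSpace n) :
    g.opN v ∈ A.weightSpace n := by
  refine Submodule.iSup_induction _ (motive := fun v => g.opN v ∈ A.weightSpace n)
    (g.weightSpace_le_iSup n hv) (fun μ x hx => ?_) (by simp) fun x y hx hy => ?_
  · exact g.opN_mem hx.2 fun k => g.sub_pow_mem (fun _ => g.toEnd_mem_weightSpace n) _ hx.1
  · rw [map_add]; exact add_mem hx hy

theorem opS_mem_weightSpace {n : ℤ} {v : V} (hv : v ∈ A.weightSpace n) :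
    g.opS v ∈ A.weightSpace n := by
  refine Submodule.iSup_induction _ (motive := fun v => g.opS v ∈ A.weightSpace n)
    (g.weightSpace_le_iSup n hv) (fun μ x hx => ?_) (by simp) fun x y hx hy => ?_
  · rw [g.opS_apply hx.2]; exact Submodule.smul_mem _ _ hx.1
  · rw [map_add]; exact add_mem hx hy

theorem opChoose_mem_weightSpace {n : ℤ} {v : V} (hv : v ∈ A.weightSpace n) (c : ℂ) (j : ℕ) :
    opChoose (c • 1 + g.opL) j v ∈ A.weightSpace n :=
  opChoose_mem (fun x hx => add_mem (by simpa using Submodule.smul_mem _ c hx)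
    (add_mem (g.opS_mem_weightSpace hx) (g.opN_mem_weightSpace hx))) j hv

/-- `𝓝` is a power series in `g - μ` without constant term, so it lowers the nilpotency order by at
least one. This permits induction on that order when `𝓝` appears as an error term. -/
theorem opN_genEigenspace {μ : ℂ} {v : V} {d : ℕ} (hv : ((g.toEnd - μ • 1) ^ (d + 1)) v = 0) :
    ((g.toEnd - μ • 1) ^ d) (g.opN v) = 0 := by
  have hmem : v ∈ g.genSpace μ := (Module.End.mem_maxGenEigenspace _ _ _).2 ⟨_, hv⟩
  refine LinearMap.mem_ker.1 (g.opN_mem hmem fun k => LinearMap.mem_ker.2 ?_)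
  rw [← Module.End.mul_apply, ← pow_add, show d + (k + 1) = k + (d + 1) by omega, pow_add,
    Module.End.mul_apply, hv, map_zero]

theorem opN_mem_genSpace {μ : ℂ} {v : V} (hv : v ∈ g.genSpace μ) : g.opN v ∈ g.genSpace μ := by
  obtain ⟨d, hd⟩ := (Module.End.mem_maxGenEigenspace _ _ _).1 hv
  refine (Module.End.mem_maxGenEigenspace _ _ _).2 ⟨d, g.opN_genEigenspace ?_⟩
  rw [pow_succ', Module.End.mul_apply, hd, map_zero]

theorem sub_pow_mode_vac (μ : ℂ) (u : V) (n : ℤ) (d : ℕ) :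
    ((g.toEnd - μ • 1) ^ d) (A.mode u n A.vac) =
      A.mode (((g.toEnd - μ • 1) ^ d) u) n A.vac := by
  induction d with
  | zero => simp
  | succ d ih =>
    rw [pow_succ', Module.End.mul_apply, Module.End.mul_apply, ih]
    have h := g.map_mode (((g.toEnd - μ • 1) ^ d) u) A.vac n
    rw [g.map_vac] at h
    rw [LinearMap.sub_apply, LinearMap.smul_apply, Module.End.one_apply, LinearMap.sub_apply,
      LinearMap.smul_apply, Module.End.one_apply, mode_sub, mode_smul, LinearMap.sub_apply,
      LinearMap.smul_apply]
    exact congrArg₂ _ h rfl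

theorem mode_vac_mem_genSpace {μ : ℂ} {u : V} (hu : u ∈ g.genSpace μ) (n : ℤ) :
    A.mode u n A.vac ∈ g.genSpace μ := by
  obtain ⟨d, hd⟩ := (Module.End.mem_maxGenEigenspace _ _ _).1 hu
  refine (Module.End.mem_maxGenEigenspace _ _ _).2 ⟨d, ?_⟩
  rw [sub_pow_mode_vac, hd, mode_zero, LinearMap.zero_apply]

/-- Every vector is a sum of vectors that are homogeneous for the weight and for the generalized
eigenspaces of `g`. -/
theorem homogeneous_induction {p : V → Prop} (h : ∀ a μ, ∀ u ∈ A.weightSpace a,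
    u ∈ g.genSpace μ → p u) (h0 : p 0) (hadd : ∀ u v, p u → p v → p (u + v)) (u : V) : p u := by
  have hu : u ∈ ⨆ n : ℤ, A.weightSpace n := by
    have : ⨆ n : ℤ, A.weightSpace n = ⊤ := A.grading.submodule_iSup_eq_top
    rw [this]; trivial
  refine Submodule.iSup_induction _ (motive := p) hu (fun a v hv => ?_) h0 hadd
  exact Submodule.iSup_induction _ (motive := p) (g.weightSpace_le_iSup a hv)
    (fun μ x hx => h a μ x hx.1 hx.2) h0 hadd

theorem weightSpace_induction {a : ℤ} {p : V → Prop} (h : ∀ μ, ∀ u ∈ A.weightSpace a,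
    u ∈ g.genSpace μ → p u) (h0 : p 0) (hadd : ∀ u v, p u → p v → p (u + v)) {u : V}
    (hu : u ∈ A.weightSpace a) : p u :=
  Submodule.iSup_induction _ (motive := p) (g.weightSpace_le_iSup a hu)
    (fun μ x hx => h μ x hx.1 hx.2) h0 hadd

/-- The part of `C₂(V)` of weight `q`. -/
def homC2 (q : ℤ) : Submodule ℂ V :=
  Submodule.span ℂ {x | ∃ (i j : ℤ) (μ : ℂ) (u v : V), i + j + 1 = q ∧ u ∈ A.weightSpace i ∧
    u ∈ g.genSpace μ ∧ v ∈ A.weightSpace j ∧ x = A.mode u (-2) v}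

theorem homC2_le (q : ℤ) : g.homC2 q ≤ A.weightSpace q := by
  refine Submodule.span_le.2 ?_
  rintro _ ⟨i, j, μ, u, v, hq, hu, -, hv, rfl⟩
  have := mode_mem_weightSpace hu hv (-2)
  rwa [show i + j - -2 - 1 = q by omega] at this

theorem C2_le_homC2_sup (q : ℤ) : A.C2 ≤ g.homC2 q ⊔ ⨆ (i : ℤ) (_ : i ≠ q), A.weightSpace i := by
  refine Submodule.span_le.2 ?_
  rintro _ ⟨u, v, rfl⟩
  rw [SetLike.mem_coe]
  induction u using g.homogeneous_induction with
  | h0 => simp [mode_zero]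
  | hadd x y hx hy => rw [mode_add, LinearMap.add_apply]; exact add_mem hx hy
  | h i μ u hu hμ =>
    induction v using g.homogeneous_induction with
    | h0 => simp
    | hadd x y hx hy => rw [map_add]; exact add_mem hx hy
    | h j ν v hv hν =>
      by_cases hq : i + j + 1 = q
      · exact Submodule.mem_sup_left (Submodule.subset_span ⟨i, j, μ, u, v, hq, hu, hμ, hv, rfl⟩)
      · refine Submodule.mem_sup_right ?_
        refine Submodule.mem_iSup_of_mem (i + j + 1) (Submodule.mem_iSup_of_mem hq ?_)
        have := mode_mem_weightSpace hu hv (-2)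
        rwa [show i + j - -2 - 1 = i + j + 1 by omega] at this

/-- If `V` is `C₂`-cofinite, then the weight spaces of large weight are contained in `C₂(V)`. -/
theorem exists_weightSpace_le_homC2 (h : A.IsC2Cofinite) :
    ∃ q₀ : ℤ, ∀ q, q₀ ≤ q → A.weightSpace q ≤ g.homC2 q := by
  -- A finite-dimensional complement of `C₂(V)` has no component of weight `q` for large `q`.
  -- Projecting to weight `q` then leaves only the homogeneous part of `C₂(V)`.
  obtain ⟨P, hP⟩ := A.C2.exists_isCompl
  have : FiniteDimensional ℂ (V ⧸ A.C2) := h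
  have hPfin : FiniteDimensional ℂ P :=
    LinearEquiv.finiteDimensional (Submodule.quotientEquivOfIsCompl _ _ hP)
  obtain ⟨t, ht⟩ : P.FG := (Submodule.fg_iff_finiteDimensional P).2 hPfin
  obtain ⟨q₀, hq₀⟩ := exists_forall_mem_iSup_ne (A := A) t
  refine ⟨q₀, fun q hq => ?_⟩
  have htop : g.homC2 q ⊔ ⨆ (i : ℤ) (_ : i ≠ q), A.weightSpace i = ⊤ := by
    rw [eq_top_iff, ← hP.sup_eq_top]
    refine sup_le (g.C2_le_homC2_sup q) ?_
    rw [← ht, Submodule.span_le]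
    exact fun x hx => Submodule.mem_sup_right (hq₀ q hq x hx)
  have hdisj : A.weightSpace q ⊓ ⨆ (i : ℤ) (_ : i ≠ q), A.weightSpace i = ⊥ :=
    (A.grading.submodule_iSupIndep q).eq_bot
  intro v hv
  obtain ⟨c, hc, y, hy, rfl⟩ := Submodule.mem_sup.1 (htop ▸ Submodule.mem_top : v ∈ _)
  have hy0 : y ∈ A.weightSpace q ⊓ ⨆ (i : ℤ) (_ : i ≠ q), A.weightSpace i :=
    ⟨by simpa using sub_mem hv (g.homC2_le q hc), hy⟩
  rw [hdisj, Submodule.mem_bot] at hy0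
  rwa [hy0, add_zero]

end Automorphism

end VertexOperatorAlgebra

/-! ### Modes on `W`: the Jacobi identity with the vacuum, and `C_n(W)` -/

namespace VertexOperatorAlgebra

variable {V : Type*} [AddCommGroup V] [Module ℂ V] {A : VertexOperatorAlgebra V}

theorem mode_neg_one_vac (u : V) : A.mode u (-1) A.vac = u :=
  A.creation_lim u

namespace WeakTwistedModule

variable {g : A.Automorphism} {W : Type*} [AddCommGroup W] [Module ℂ W]
  (M : A.WeakTwistedModule g W)

theorem mode_add (u v : V) (n : ℂ) (k : ℕ) : M.mode (u + v) n k = M.mode u n k + M.mode v n k := by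
  rw [map_add]; rfl

theorem mode_smul (c : ℂ) (u : V) (n : ℂ) (k : ℕ) : M.mode (c • u) n k = c • M.mode u n k := by
  rw [map_smul]; rfl

theorem mode_zero (n : ℂ) (k : ℕ) : M.mode 0 n k = 0 := by
  rw [map_zero]; rfl

/-- The Jacobi identity for the modes `u(n, 0)`. -/
theorem jacobi_zero {μ : ℂ} {u : V} (hu : u ∈ g.genSpace μ) (v : V) (w : W) (l r : ℤ) (m n : ℂ)
    (hm : m = twistExponent μ + r) :
    (∑ᶠ i : ℕ, ((-1 : ℂ) ^ i * (Ring.choose l i : ℤ)) •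
        M.mode u (m + l - i) 0 (M.mode v (n + i) 0 w)) -
      (∑ᶠ i : ℕ, ((-1 : ℂ) ^ (l + i) * (Ring.choose l i : ℤ)) •
        M.mode v (n + l - i) 0 (M.mode u (m + i) 0 w)) =
    ∑ᶠ j : ℕ, M.mode (A.mode (opChoose ((r : ℂ) • 1 + g.opL) j u) (l + j) v) (m + n - j) 0 w := by
  rw [M.jacobi _ u v w (g.genSpace_le_component μ hu) l r m n 0 0 hm]
  refine finsum_congr fun j => ?_
  simp

theorem finsum_mode_vac (f : ℕ → Module.End ℂ W) (w : W) :
    ∑ᶠ i : ℕ, f i (M.mode A.vac (-1 + i) 0 w) = f 0 w := by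
  rw [finsum_eq_single _ 0]
  · rw [M.identity]; simp
  · intro i hi
    rw [M.identity, if_neg (by simpa using hi), map_zero]

theorem finsum_vac_mode (c : ℕ → ℂ) (l : ℤ) (hl : l < 0) (f : ℕ → W) :
    ∑ᶠ i : ℕ, c i • M.mode A.vac (-1 + l - i) 0 (f i) = 0 := by
  refine finsum_eq_zero_of_forall_eq_zero fun i => ?_
  rw [M.identity, if_neg, smul_zero]
  rintro ⟨h, -⟩
  have h' : ((l - i : ℤ) : ℂ) = 0 := by push_cast; linear_combination h
  rw [Int.cast_eq_zero] at h'
  omega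

/-- The logarithmic modes are determined by the modes `u(n, 0)`. -/
theorem mode_eq_opN {μ : ℂ} {u : V} (hu : u ∈ g.genSpace μ) (r : ℤ) {m : ℂ}
    (hm : m = twistExponent μ + r) (k : ℕ) (w : W) :
    M.mode u m k w = ((-1 : ℂ) ^ k / (k ! : ℂ)) • M.mode ((g.opN ^ k) u) m 0 w := by
  -- With the vacuum as second vector, at index `-1`, only one term survives on the left. The index
  -- `m + 1` compensates for `l = -1`, and the creation property kills all `j > 0` on the right.
  have h := M.jacobi _ u A.vac w (g.genSpace_le_component μ hu) (-1) (r + 1) (m + 1) (-1) k 0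
    (by rw [hm]; push_cast; ring)
  have h1 := M.finsum_mode_vac (fun i : ℕ => ((-1 : ℂ) ^ i * (Ring.choose (-1 : ℤ) i : ℤ)) •
    M.mode u (m + 1 + (-1 : ℤ) - i) k) w
  simp only [LinearMap.smul_apply] at h1
  rw [h1, M.finsum_vac_mode _ (-1) (by norm_num), finsum_eq_single _ 0] at h
  · simp only [pow_zero, Ring.choose_zero_right, Int.cast_one, mul_one, one_smul, sub_zero,
      Nat.cast_zero, Int.reduceNeg, Int.cast_neg, add_neg_cancel_right, opChoose_zero,
      zero_add, Finset.range_one, Finset.sum_singleton, Nat.factorial_zero, Nat.cast_one,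
      add_zero, Module.End.one_apply] at h
    rw [h, mode_neg_one_vac]
  · intro j hj
    refine Finset.sum_eq_zero fun a _ => ?_
    have hz : A.mode (opChoose (((r + 1 : ℤ) : ℂ) • 1 + g.opL) j ((g.opN ^ (a + k)) u))
        (-1 + j) A.vac = 0 := A.creation _ _ (by omega)
    rw [hz, mode_zero, LinearMap.zero_apply, smul_zero]

theorem mode_eq_zero {μ : ℂ} {u : V} (hu : u ∈ g.genSpace μ) {m : ℂ}
    (hm : ∀ r : ℤ, m ≠ twistExponent μ + r) (k : ℕ) (w : W) : M.mode u m k w = 0 := by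
  have h := M.jacobi_of_ne _ u A.vac w (g.genSpace_le_component μ hu) (-1) (m + 1) (-1) k 0
    (fun r hr => hm (r - 1) (by push_cast; linear_combination hr))
  have h1 := M.finsum_mode_vac (fun i : ℕ => ((-1 : ℂ) ^ i * (Ring.choose (-1 : ℤ) i : ℤ)) •
    M.mode u (m + 1 + (-1 : ℤ) - i) k) w
  simp only [LinearMap.smul_apply] at h1
  rw [h1, M.finsum_vac_mode _ (-1) (by norm_num)] at h
  simpa using h

/-- The modes of `L(-1)u = u(-2)1`. -/
theorem mode_mode_vac {μ : ℂ} {u : V} (hu : u ∈ g.genSpace μ) (r : ℤ) {m : ℂ}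
    (hm : m = twistExponent μ + r) (w : W) :
    M.mode (A.mode u (-2) A.vac) m 0 w =
      -(m • M.mode u (m - 1) 0 w + M.mode (g.opN u) (m - 1) 0 w) := by
  -- With `l = -2`, creation leaves `j = 0` and `j = 1` on the right. The second of these carries `r
  -- + 1 + 𝓛`, which is `(m + 1) + 𝓝` on `u`.
  have h := M.jacobi_zero hu A.vac w (-2) (r + 1) (m + 1) (-1) (by rw [hm]; push_cast; ring)
  have h1 := M.finsum_mode_vac (fun i : ℕ => ((-1 : ℂ) ^ i * (Ring.choose (-2 : ℤ) i : ℤ)) •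
    M.mode u (m + 1 + (-2 : ℤ) - i) 0) w
  simp only [LinearMap.smul_apply] at h1
  rw [h1, M.finsum_vac_mode _ (-2) (by norm_num),
    finsum_eq_sum_of_support_subset (s := Finset.range 2)] at h
  · have hL : opChoose (((r + 1 : ℤ) : ℂ) • 1 + g.opL) 1 u = (m + 1) • u + g.opN u := by
      rw [opChoose_one, Automorphism.opL, LinearMap.add_apply, LinearMap.add_apply,
        g.opS_apply hu, hm]
      simp only [LinearMap.smul_apply, Module.End.one_apply]
      push_cast
      module
    simp only [Finset.sum_range_succ, Finset.sum_range_zero, opChoose_zero, hL,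
      Ring.choose_zero_right] at h
    simp only [pow_zero, Int.cast_one, mul_one, one_smul, Nat.cast_zero, Nat.cast_one, sub_zero,
      zero_add, Module.End.one_apply, add_zero, add_neg_cancel_right] at h
    rw [show (-2 : ℤ) + 1 = -1 by norm_num, mode_neg_one_vac, mode_add, mode_smul,
      LinearMap.add_apply,
      LinearMap.smul_apply, show m + 1 + ((-2 : ℤ) : ℂ) = m - 1 by push_cast; ring] at h
    rw [eq_neg_iff_add_eq_zero]
    refine Eq.trans ?_ (neg_eq_zero.2 (sub_eq_zero.2 h))
    module
  · intro j hj
    by_contra hlt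
    apply hj
    have hz : A.mode (opChoose (((r + 1 : ℤ) : ℂ) • 1 + g.opL) j u) (-2 + j) A.vac = 0 :=
      A.creation _ _ (by simp at hlt; omega)
    beta_reduce
    rw [hz, mode_zero, LinearMap.zero_apply]

/-- The derivative formula, solved for the lower mode, expresses a multiple of `u(α - k - 1)` by a
mode of `u(-2)1` at `α - k` and a mode of `𝓝u`. The first is handled by induction on `k`, at weight
`b + 1`; the second by induction on the nilpotency order of `g - μ` on `u`. -/
theorem mode_mem_C {n : ℕ} (hn : 0 < n) {k : ℕ} (hk : n ≤ k) {b : ℤ} (hb : 0 < b) {μ : ℂ} {u : V}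
    (hu : u ∈ A.weightSpace b) (hμ : u ∈ g.genSpace μ) (w : W) :
    M.mode u (twistExponent μ - k) 0 w ∈ M.C n := by
  induction k, hk using Nat.le_induction generalizing b u with
  | base =>
    by_cases h0 : u = 0
    · rw [h0, mode_zero]; exact zero_mem _
    refine Submodule.subset_span ⟨twistExponent μ, ?_, u, g.genSpace_le_component μ hμ, w,
      fun _ => ?_, rfl⟩
    · exact Module.End.hasEigenvalue_of_hasEigenvector ⟨g.genSpace_le_component μ hμ, h0⟩
    · exact Submodule.mem_iSup_of_mem b (Submodule.mem_iSup_of_mem hb hu)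
  | succ k hk ih =>
    obtain ⟨d, hd⟩ := (Module.End.mem_maxGenEigenspace _ _ _).1 hμ
    induction d generalizing u with
    | zero =>
      have h0 : u = 0 := by simpa using hd
      rw [h0, mode_zero]; exact zero_mem _
    | succ d ihd =>
      have h := M.mode_mode_vac hμ (-k) (m := twistExponent μ - k) (by push_cast; ring) w
      have h1 : M.mode (A.mode u (-2) A.vac) (twistExponent μ - k) 0 w ∈ M.C n := by
        refine ih (b := b + 1) (by omega) ?_ (g.mode_vac_mem_genSpace hμ _)
        have := mode_mem_weightSpace hu vac_mem_weightSpace (-2)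
        rwa [show b + 0 - -2 - 1 = b + 1 by ring] at this
      have h2 := ihd (g.opN_mem_weightSpace hu) (g.opN_mem_genSpace hμ) (g.opN_genEigenspace hd)
      -- The coefficient is invertible because `Re α < 1 ≤ k`; this is where `n > 0` enters.
      have hne : twistExponent μ - k ≠ 0 := by
        intro h0
        have h3 := congrArg Complex.re h0
        rw [Complex.sub_re, Complex.natCast_re, Complex.zero_re] at h3
        have h4 := twistExponent_re_lt_one μ
        have h5 : (1 : ℝ) ≤ k := by exact_mod_cast hn.trans_le hk
        linarith
      have e : twistExponent μ - ((k + 1 : ℕ) : ℂ) = twistExponent μ - k - 1 := by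
        push_cast; ring
      rw [e] at h2 ⊢
      rw [← Submodule.smul_mem_iff _ hne]
      rw [h] at h1
      simpa using sub_mem (neg_mem h1) h2

end WeakTwistedModule
end VertexOperatorAlgebra

/-! ### Operators of bounded degree on a filtered space -/

/-- The operators that raise the degree in a filtration by at most `q`. -/
def opFilt {W : Type*} [AddCommGroup W] [Module ℂ W] (F : ℤ → Submodule ℂ W) (q : ℤ) :
    Submodule ℂ (Module.End ℂ W) where
  carrier := {T | ∀ p, ∀ w ∈ F p, T w ∈ F (p + q)}
  add_mem' hS hT p w hw := add_mem (hS p w hw) (hT p w hw)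
  zero_mem' _ _ _ := zero_mem _
  smul_mem' c _ hT p w hw := Submodule.smul_mem _ c (hT p w hw)

section opFilt

variable {W : Type*} [AddCommGroup W] [Module ℂ W] {F : ℤ → Submodule ℂ W}

theorem opFilt_apply_mem {q : ℤ} {T : Module.End ℂ W} (hT : T ∈ opFilt F q) {p p' : ℤ} {w : W}
    (hw : w ∈ F p) (h : p + q = p') : T w ∈ F p' :=
  h ▸ hT p w hw

theorem opFilt_mul_mem {a b : ℤ} {S T : Module.End ℂ W} (hS : S ∈ opFilt F a)
    (hT : T ∈ opFilt F b) : S * T ∈ opFilt F (a + b) :=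
  fun _ _ hw => opFilt_apply_mem hS (hT _ _ hw) (by ring)

theorem opFilt_one_mem : (1 : Module.End ℂ W) ∈ opFilt F 0 :=
  fun _ _ hw => by simpa using hw

theorem opFilt_pow_mem {a : ℤ} {T : Module.End ℂ W} (hT : T ∈ opFilt F a) (n : ℕ) :
    T ^ n ∈ opFilt F (n * a) := by
  induction n with
  | zero => simpa using opFilt_one_mem
  | succ n ih =>
    rw [pow_succ, show ((n + 1 : ℕ) : ℤ) * a = n * a + a by push_cast; ring]
    exact opFilt_mul_mem ih hT

theorem opFilt_mono (hF : Monotone F) {a b : ℤ} (h : a ≤ b) : opFilt F a ≤ opFilt F b :=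
  fun _ hT _ w hw => hF (by omega) (hT _ w hw)

end opFilt

/-! ### The weight filtration of `W` and the degrees of modes -/

namespace VertexOperatorAlgebra

variable {V : Type*} [AddCommGroup V] [Module ℂ V] {A : VertexOperatorAlgebra V}

namespace WeakTwistedModule

variable {g : A.Automorphism} {W : Type*} [AddCommGroup W] [Module ℂ W]
  (M : A.WeakTwistedModule g W)

/-- The vectors `u₁(n₁) ⋯ u_k(n_k) x`, `x ∈ s`, with homogeneous `u_i` of positive weights that
sum to `p`. -/
inductive IsMonomial (s : Set W) : ℤ → W → Prop
  | base {x : W} (hx : x ∈ s) : IsMonomial s 0 x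
  | step {p q : ℤ} {u : V} {w : W} (n : ℂ) (hq : 1 ≤ q) (hu : u ∈ A.weightSpace q)
      (hw : IsMonomial s p w) : IsMonomial s (p + q) (M.mode u n 0 w)

/-- The filtration of a weak twisted module by the sum of the weights of the operators that are
applied to a generator. -/
def filt (s : Set W) (p : ℤ) : Submodule ℂ W :=
  Submodule.span ℂ {w | ∃ p' ≤ p, M.IsMonomial s p' w}

variable {M} {s : Set W}

theorem IsMonomial.nonneg {p : ℤ} {w : W} (h : M.IsMonomial s p w) : 0 ≤ p := by
  induction h with
  | base hx => exact le_rfl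
  | step n hq hu hw ih => omega

theorem IsMonomial.mem_filt {p : ℤ} {w : W} (h : M.IsMonomial s p w) : w ∈ M.filt s p :=
  Submodule.subset_span ⟨p, le_rfl, h⟩

theorem filt_mono : Monotone (M.filt s) := fun _ _ h =>
  Submodule.span_mono fun _ ⟨p', hp', hw⟩ => ⟨p', hp'.trans h, hw⟩

theorem filt_of_neg {p : ℤ} (hp : p < 0) : M.filt s p = ⊥ := by
  rw [filt, Submodule.span_eq_bot]
  rintro w ⟨p', hp', hw⟩
  have := hw.nonneg
  omega

theorem mem_opFilt_of_isMonomial {T : Module.End ℂ W} {q : ℤ}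
    (h : ∀ p w, M.IsMonomial s p w → T w ∈ M.filt s (p + q)) : T ∈ opFilt (M.filt s) q := by
  intro p w hw
  have hle : M.filt s p ≤ (M.filt s (p + q)).comap T := by
    refine Submodule.span_le.2 ?_
    rintro w ⟨p', hp', hw⟩
    exact filt_mono (by omega) (h p' w hw)
  exact hle hw

/-- CFT type covers the weights that monomials exclude: there are no vectors of negative weight, and
modes of multiples of the vacuum are scalars. -/
theorem mode_mem_opFilt (hCFT : A.IsCFTType) {q : ℤ} {u : V} (hu : u ∈ A.weightSpace q) (n : ℂ) :
    M.mode u n 0 ∈ opFilt (M.filt s) q := by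
  rcases lt_trichotomy q 0 with hq | rfl | hq
  · rw [hCFT.1 q hq, Submodule.mem_bot] at hu
    rw [hu, mode_zero]
    exact zero_mem _
  · rw [hCFT.2, Submodule.mem_span_singleton] at hu
    obtain ⟨c, rfl⟩ := hu
    rw [mode_smul]
    refine Submodule.smul_mem _ c fun p w hw => ?_
    rw [M.identity, add_zero]
    split_ifs
    · exact hw
    · exact zero_mem _
  · exact mem_opFilt_of_isMonomial fun p w hw => (hw.step n hq hu).mem_filt

theorem mode_opChoose_mem_filt (hCFT : A.IsCFTType) {a b : ℤ} {u v : V}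
    (hu : u ∈ A.weightSpace a) (hv : v ∈ A.weightSpace b) {p : ℤ} {w : W} (hw : w ∈ M.filt s p)
    (c : ℂ) (j : ℕ) (l : ℤ) (n : ℂ) :
    M.mode (A.mode (opChoose (c • 1 + g.opL) j u) l v) n 0 w ∈ M.filt s (p + (a + b - l - 1)) :=
  mode_mem_opFilt hCFT
    (mode_mem_weightSpace (g.opChoose_mem_weightSpace hu c j) hv l) n p w hw

/-- The `j`-th term on the right of the Jacobi identity involves a vector of weight `a + b - l - j -
1`, so everything after `j = 0` has smaller degree. -/
theorem mode_mode_sub_mem_filt (hCFT : A.IsCFTType) {a b : ℤ} {u v : V}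
    (hu : u ∈ A.weightSpace a) (hv : v ∈ A.weightSpace b) {p : ℤ} {w : W} (hw : w ∈ M.filt s p)
    (c : ℂ) (l : ℤ) (n : ℂ) :
    ∑ᶠ j : ℕ, M.mode (A.mode (opChoose (c • 1 + g.opL) j u) (l + j) v) (n - j) 0 w -
      M.mode (A.mode u l v) n 0 w ∈ M.filt s (p + (a + b - l - 2)) := by
  have h := finsum_sub_sum_range_mem (M.filt s (p + (a + b - l - 2)))
    (f := fun j : ℕ => M.mode (A.mode (opChoose (c • 1 + g.opL) j u) (l + j) v) (n - j) 0 w)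
    (a + b - l).toNat 1 (fun i hi => ?_) fun i hi => ?_
  · simpa [opChoose_zero] using h
  · have h0 := mode_mem_weightSpace (g.opChoose_mem_weightSpace hu c i) hv (l + i)
    rw [hCFT.1 _ (by omega), Submodule.mem_bot] at h0
    rw [h0, mode_zero, LinearMap.zero_apply]
  · exact filt_mono (by omega) (mode_opChoose_mem_filt hCFT hu hv hw c i (l + i) _)

theorem mode_mode_mem_filt (hCFT : A.IsCFTType) {a b : ℤ} {u v : V} (hu : u ∈ A.weightSpace a)
    (hv : v ∈ A.weightSpace b) {p : ℤ} {w : W} (hw : w ∈ M.filt s p) (m n : ℂ) :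
    M.mode u m 0 (M.mode v n 0 w) ∈ M.filt s (p + (a + b)) :=
  opFilt_apply_mem (mode_mem_opFilt hCFT hu m) (mode_mem_opFilt hCFT hv n _ _ hw) (by ring)

/-- For `l = 0` the Jacobi identity is the commutator formula, and its right-hand side involves only
vectors of weight at most `a + b - 1`. For indices outside the coset of the twist exponent the
commutator is zero. -/
theorem commutator_mem_opFilt (hCFT : A.IsCFTType) {a b : ℤ} {u v : V} (hu : u ∈ A.weightSpace a)
    (hv : v ∈ A.weightSpace b) (m n : ℂ) :
    M.mode u m 0 * M.mode v n 0 - M.mode v n 0 * M.mode u m 0 ∈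
      opFilt (M.filt s) (a + b - 1) := by
  refine g.weightSpace_induction (p := fun u => M.mode u m 0 * M.mode v n 0 -
    M.mode v n 0 * M.mode u m 0 ∈ opFilt (M.filt s) (a + b - 1)) (fun μ u hu hμ => ?_) ?_ ?_ hu
  · have e1 (w : W) : (∑ᶠ i : ℕ, ((-1 : ℂ) ^ i * (Ring.choose (0 : ℤ) i : ℤ)) •
        M.mode u (m + (0 : ℤ) - i) 0 (M.mode v (n + i) 0 w)) =
          M.mode u m 0 (M.mode v n 0 w) := by
      rw [finsum_eq_single _ 0 fun i hi => by
        simp [Ring.choose_zero_pos ℤ (Nat.pos_of_ne_zero hi)]]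
      simp
    have e2 (w : W) : (∑ᶠ i : ℕ, ((-1 : ℂ) ^ ((0 : ℤ) + i) * (Ring.choose (0 : ℤ) i : ℤ)) •
        M.mode v (n + (0 : ℤ) - i) 0 (M.mode u (m + i) 0 w)) =
          M.mode v n 0 (M.mode u m 0 w) := by
      rw [finsum_eq_single _ 0 fun i hi => by
        simp [Ring.choose_zero_pos ℤ (Nat.pos_of_ne_zero hi)]]
      simp
    intro p w hw
    simp only [LinearMap.sub_apply, Module.End.mul_apply]
    by_cases hm : ∃ r : ℤ, m = twistExponent μ + r
    · obtain ⟨r, hm⟩ := hm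
      have h := M.jacobi_zero hμ v w 0 r m n hm
      rw [e1, e2] at h
      rw [h]
      exact finsum_mem_submodule _ fun j =>
        filt_mono (by omega) (mode_opChoose_mem_filt hCFT hu hv hw r j (0 + j) _)
    · push Not at hm
      have h := M.jacobi_of_ne _ u v w (g.genSpace_le_component μ hμ) 0 m n 0 0 hm
      rw [e1, e2] at h
      rw [h]
      exact zero_mem _
  · simp [mode_zero]
  · intro x y hx hy
    convert add_mem hx hy using 1
    rw [mode_add]
    noncomm_ring

theorem commutator_apply_mem (hCFT : A.IsCFTType) {a b : ℤ} {u v : V} (hu : u ∈ A.weightSpace a)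
    (hv : v ∈ A.weightSpace b) (m n : ℂ) {p : ℤ} {w : W} (hw : w ∈ M.filt s p) :
    M.mode u m 0 (M.mode v n 0 w) - M.mode v n 0 (M.mode u m 0 w) ∈
      M.filt s (p + (a + b - 1)) :=
  commutator_mem_opFilt hCFT hu hv m n p w hw

/-- The modes of elements of `C₂(V)` lower the filtration degree that their weight allows. -/
theorem mode_mem_opFilt_of_homC2 (hCFT : A.IsCFTType) {q : ℤ} {u : V} (hu : u ∈ g.homC2 q)
    (n : ℂ) : M.mode u n 0 ∈ opFilt (M.filt s) (q - 1) := by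
  induction hu using Submodule.span_induction with
  | zero => rw [mode_zero]; exact zero_mem _
  | add x y _ _ hx hy => rw [mode_add]; exact add_mem hx hy
  | smul c x _ hx => rw [mode_smul]; exact Submodule.smul_mem _ c hx
  | mem x hx =>
    obtain ⟨i, j, μ, u, v, rfl, hu, hμ, hv, rfl⟩ := hx
    intro p w hw
    -- At `l = -2` the leading term on the right is the mode of `u(-2)v`, of weight `i + j + 1`,
    -- while the products on the left have degree only `i + j`.
    have h := M.jacobi_zero hμ v w (-2) 0 (twistExponent μ) (n - twistExponent μ) (by simp)
    rw [add_sub_cancel] at h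
    have h1 := mode_mode_sub_mem_filt hCFT hu hv hw ((0 : ℤ) : ℂ) (-2) n
    rw [← h] at h1
    rw [show p + (i + j - -2 - 2) = p + (i + j) by ring] at h1
    rw [show p + (i + j + 1 - 1) = p + (i + j) by ring]
    rw [← sub_sub_cancel (_ - _) (M.mode (A.mode u (-2) v) n 0 w)]
    refine sub_mem (sub_mem ?_ ?_) h1
    · exact finsum_mem_submodule _ fun i =>
        Submodule.smul_mem _ _ (mode_mode_mem_filt hCFT hu hv hw _ _)
    · refine finsum_mem_submodule _ fun k => Submodule.smul_mem _ _ ?_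
      rw [add_comm i j]
      exact mode_mode_mem_filt hCFT hv hu hw _ _

/-- The modes of `u(-1)v` are convolution products, up to operators of smaller degree. -/
theorem mode_neg_one_sub_mem_opFilt (hCFT : A.IsCFTType) {a b : ℤ} {μ : ℂ} {u v : V}
    (hu : u ∈ A.weightSpace a) (hμ : u ∈ g.genSpace μ) (hv : v ∈ A.weightSpace b) {r : ℤ} {m : ℂ}
    (hm : m = twistExponent μ + r) (n : ℂ) {I : ℕ}
    (hIu : ∀ i : ℕ, I ≤ i → M.mode u (m + i) 0 ∈ opFilt (M.filt s) (a - 1))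
    (hIv : ∀ i : ℕ, I ≤ i → M.mode v (n + i) 0 ∈ opFilt (M.filt s) (b - 1)) :
    M.mode (A.mode u (-1) v) (m + n) 0 -
      (∑ i ∈ Finset.range I, M.mode u (m - 1 - i) 0 * M.mode v (n + i) 0 +
        ∑ i ∈ Finset.range I, M.mode v (n - 1 - i) 0 * M.mode u (m + i) 0) ∈
      opFilt (M.filt s) (a + b - 1) := by
  intro p w hw
  -- At `l = -1` all binomial coefficients become signs, and the left-hand side is a sum of two
  -- plain convolutions. By `hIu` and `hIv` their tails have lower degree.
  have h := M.jacobi_zero hμ v w (-1) r m n hm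
  have c1 (i : ℕ) : (-1 : ℂ) ^ i * (Ring.choose (-1 : ℤ) i : ℤ) = 1 := by
    rw [Ring.choose_neg_one_int]
    push_cast
    rw [← mul_pow]; simp
  have c2 (i : ℕ) : (-1 : ℂ) ^ ((-1 : ℤ) + i) * (Ring.choose (-1 : ℤ) i : ℤ) = -1 := by
    rw [zpow_add₀ (by norm_num), zpow_natCast, mul_assoc, c1]; norm_num
  simp only [c1, c2, one_smul, neg_smul, finsum_neg_distrib, sub_neg_eq_add] at h
  have h1 := mode_mode_sub_mem_filt hCFT hu hv hw (r : ℂ) (-1) (m + n)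
  rw [← h, show p + (a + b - -1 - 2) = p + (a + b - 1) by ring] at h1
  obtain ⟨N₁, hN₁⟩ := M.lower_truncation v w n 0
  obtain ⟨N₂, hN₂⟩ := M.lower_truncation u w m 0
  have h2 := finsum_sub_sum_range_mem (M.filt s (p + (a + b - 1)))
    (f := fun i : ℕ => M.mode u (m + (-1 : ℤ) - i) 0 (M.mode v (n + i) 0 w)) N₁.toNat I
    (fun i hi => by
      have := hN₁ i (by omega)
      rw [Int.cast_natCast] at this
      simp [this])
    (fun i hi => opFilt_apply_mem (mode_mem_opFilt hCFT hu _)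
      (hIv i hi _ _ hw) (by ring))
  have h3 := finsum_sub_sum_range_mem (M.filt s (p + (a + b - 1)))
    (f := fun i : ℕ => M.mode v (n + (-1 : ℤ) - i) 0 (M.mode u (m + i) 0 w)) N₂.toNat I
    (fun i hi => by
      have := hN₂ i (by omega)
      rw [Int.cast_natCast] at this
      simp [this])
    (fun i hi => opFilt_apply_mem (mode_mem_opFilt hCFT hv _)
      (hIu i hi _ _ hw) (by ring))
  have h4 := sub_mem (add_mem h2 h3) h1
  convert h4 using 1
  simp only [LinearMap.sub_apply, LinearMap.add_apply, LinearMap.sum_apply, Module.End.mul_apply,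
    Int.cast_neg, Int.cast_one, ← sub_eq_add_neg]
  abel

/-- Move the mode through a monomial to the generator, which it kills; each commutator met on the
way costs one degree. -/
theorem mode_mem_opFilt_of_forall_eq_zero (hCFT : A.IsCFTType) {a : ℤ} {u : V}
    (hu : u ∈ A.weightSpace a) {n : ℂ} (h : ∀ x ∈ s, M.mode u n 0 x = 0) :
    M.mode u n 0 ∈ opFilt (M.filt s) (a - 1) := by
  refine mem_opFilt_of_isMonomial fun p w hw => ?_
  induction hw with
  | base hx => rw [h _ hx]; exact zero_mem _
  | @step p q v w m hq hv hw ih =>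
    have h1 := commutator_apply_mem hCFT hu hv n m hw.mem_filt
    have h2 := opFilt_apply_mem (mode_mem_opFilt hCFT hv m) ih
      (show p + (a - 1) + q = p + (a + q - 1) by ring)
    have h3 := add_mem h1 h2
    rw [sub_add_cancel] at h3
    rwa [show p + q + (a - 1) = p + (a + q - 1) by ring]

/-- Lower truncation depends on the vector, but modulo lower degree a bound that works for the
finitely many generators works on all of `W`. -/
theorem exists_mode_mem_opFilt (hCFT : A.IsCFTType) (hs : s.Finite) {a : ℤ} {u : V}
    (hu : u ∈ A.weightSpace a) (n : ℂ) :
    ∃ N : ℤ, ∀ l : ℤ, N ≤ l → M.mode u (n + l) 0 ∈ opFilt (M.filt s) (a - 1) := by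
  choose f hf using fun x => M.lower_truncation u x n 0
  obtain ⟨N, hN⟩ := (hs.image f).bddAbove
  exact ⟨N, fun l hl => mode_mem_opFilt_of_forall_eq_zero hCFT hu fun x hx =>
    hf x l ((hN (Set.mem_image_of_mem f hx)).trans hl)⟩

/-- The union of the filtration is stable under the logarithmic modes too, since they are multiples
of modes `(𝓝^k u)(n, 0)`. -/
theorem exists_mem_filt (hCFT : A.IsCFTType)
    (h : ∀ p : Submodule ℂ W, (∀ w ∈ s, w ∈ p) →
      (∀ (u : V) (n : ℂ) (k : ℕ) (w : W), w ∈ p → M.mode u n k w ∈ p) → p = ⊤) (w : W) :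
    ∃ p, w ∈ M.filt s p := by
  rw [← Submodule.mem_iSup_of_directed _ filt_mono.directed_le]
  have htop : ⨆ p, M.filt s p = ⊤ := by
    refine h _ (fun x hx => Submodule.mem_iSup_of_mem 0 (IsMonomial.base hx).mem_filt) ?_
    intro u n k w hw
    induction u using g.homogeneous_induction with
    | h0 => rw [mode_zero]; exact zero_mem _
    | hadd x y hx hy => rw [mode_add]; exact add_mem hx hy
    | h a μ u hu hμ =>
      by_cases hr : ∃ r : ℤ, n = twistExponent μ + r
      · obtain ⟨r, hr⟩ := hr
        rw [M.mode_eq_opN hμ r hr]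
        refine Submodule.smul_mem _ _ ?_
        have hk : (g.opN ^ k) u ∈ A.weightSpace a := by
          clear hw
          induction k with
          | zero => simpa
          | succ k ih =>
            rw [pow_succ', Module.End.mul_apply]
            exact g.opN_mem_weightSpace ih
        obtain ⟨p, hp⟩ := (Submodule.mem_iSup_of_directed _ filt_mono.directed_le).1 hw
        exact Submodule.mem_iSup_of_mem (p + a) (mode_mem_opFilt hCFT hk n p w hp)
      · push Not at hr
        rw [M.mode_eq_zero hμ hr]
        exact zero_mem _
  rw [htop]
  trivial

variable (M s) in
/-- The part of `C_n(W)` that is spanned by vectors `u(α - k) w`, `k ≥ n`, of degree at most `p`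
in the filtration. -/
def filtC (n : ℕ) (p : ℤ) : Submodule ℂ W :=
  Submodule.span ℂ {x | ∃ (k : ℕ) (b : ℤ) (μ : ℂ) (u : V) (y : W), n ≤ k ∧ 0 < b ∧
    u ∈ A.weightSpace b ∧ u ∈ g.genSpace μ ∧ y ∈ M.filt s (p - b) ∧
    x = M.mode u (twistExponent μ - k) 0 y}

theorem filtC_le_C {n : ℕ} (hn : 0 < n) (p : ℤ) : M.filtC s n p ≤ M.C n := by
  refine Submodule.span_le.2 ?_
  rintro _ ⟨k, b, μ, u, y, hk, hb, hu, hμ, -, rfl⟩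
  exact M.mode_mem_C hn hk hb hu hμ y

/-- Commute the new mode past the outer one: the main term keeps the form that defines `filtC`, with
the new mode absorbed into `y`, and the commutator has lower degree. -/
theorem mode_mem_filtC_sup (hCFT : A.IsCFTType) {n : ℕ} {p q : ℤ} {v : V}
    (hv : v ∈ A.weightSpace q) (m : ℂ) {w : W} (hw : w ∈ M.filtC s n p) :
    M.mode v m 0 w ∈ M.filt s (p + q - 1) ⊔ M.filtC s n (p + q) := by
  induction hw using Submodule.span_induction with
  | zero => simp
  | add x y _ _ hx hy => rw [map_add]; exact add_mem hx hy
  | smul c x _ hx => rw [map_smul]; exact Submodule.smul_mem _ c hx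
  | mem x hx =>
    obtain ⟨k, b, μ, u, y, hk, hb, hu, hμ, hy, rfl⟩ := hx
    have h1 := commutator_apply_mem hCFT hv hu m (twistExponent μ - k) hy
    rw [← sub_add_cancel (M.mode v m 0 _)
      (M.mode u (twistExponent μ - k) 0 (M.mode v m 0 y))]
    refine add_mem (Submodule.mem_sup_left (filt_mono (by omega) h1)) (Submodule.mem_sup_right ?_)
    exact Submodule.subset_span ⟨k, b, μ, u, _, hk, hb, hu, hμ,
      opFilt_apply_mem (mode_mem_opFilt hCFT hv m) hy (by ring), rfl⟩

end WeakTwistedModule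
end VertexOperatorAlgebra

/-- The `y j` behave as convolution powers of the sequence `x`, which vanishes in high degree.
Modulo the nilradical, if all `x r'` with `r' > r` vanish, then `y j` has top term `x r ^ j` in
degree `j * r`; since `y Q = 0`, `x r` is nilpotent. Descending induction from the vanishing range
reaches every `r`. -/
theorem isNilpotent_of_convolution {K : Type*} [CommRing K] (x : ℤ → K) (y : ℕ → ℤ → K)
    (y_zero_zero : y 0 0 = 1) (y_zero : ∀ t, t ≠ 0 → y 0 t = 0)
    (hx : ∃ T, ∀ r, T ≤ r → x r = 0)
    (hy : ∀ (j : ℕ) (r t : ℤ), ∃ I : ℕ, y (j + 1) (r + t) =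
      ∑ i ∈ Finset.range (I + 1), x (r - i) * y j (t + i) +
        ∑ i ∈ Finset.range (I + 1), y j (t - 1 - i) * x (r + 1 + i))
    (hQ : ∃ Q, ∀ t, y Q t = 0) (r : ℤ) : IsNilpotent (x r) := by
  have step : ∀ r, (∀ r', r < r' → x r' ∈ nilradical K) → x r ∈ nilradical K := by
    intro r hr
    have key : ∀ j : ℕ, (∀ t, j * r < t → y j t ∈ nilradical K) ∧
        y j (j * r) - x r ^ j ∈ nilradical K := by
      intro j
      induction j with
      | zero => exact ⟨fun t ht => by rw [y_zero t (by simp at ht; omega)]; exact zero_mem _,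
          by simp [y_zero_zero]⟩
      | succ j ih =>
        have h2 (t : ℤ) (I : ℕ) : ∑ i ∈ Finset.range (I + 1), y j (t - 1 - i) * x (r + 1 + i) ∈
            nilradical K :=
          Ideal.sum_mem _ fun i _ => Ideal.mul_mem_left _ _ (hr _ (by omega))
        constructor
        · intro t ht
          obtain ⟨I, hI⟩ := hy j r (t - r)
          rw [add_sub_cancel] at hI
          rw [hI]
          refine add_mem (Ideal.sum_mem _ fun i _ => Ideal.mul_mem_left _ _ (ih.1 _ ?_)) (h2 _ _)
          push_cast at ht
          linarith
        · obtain ⟨I, hI⟩ := hy j r (j * r)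
          rw [show ((j + 1 : ℕ) : ℤ) * r = r + j * r by push_cast; ring, hI,
            Finset.sum_range_succ', pow_succ']
          have h1 : ∑ i ∈ Finset.range I, x (r - (i + 1 : ℕ)) * y j (j * r + (i + 1 : ℕ)) ∈
              nilradical K :=
            Ideal.sum_mem _ fun i _ => Ideal.mul_mem_left _ _ (ih.1 _ (by omega))
          have h3 := Ideal.mul_mem_left _ (x r) ih.2
          have h4 := add_mem (add_mem h1 h3) (h2 (j * r) I)
          convert h4 using 1
          simp only [Nat.cast_zero, sub_zero, add_zero]
          ring
    obtain ⟨Q, hQ⟩ := hQ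
    have h := (key Q).2
    rw [hQ, zero_sub, neg_mem_iff, mem_nilradical] at h
    exact mem_nilradical.2 h.of_pow
  obtain ⟨T, hT⟩ := hx
  have all : ∀ (d : ℕ) (r : ℤ), T - d ≤ r → x r ∈ nilradical K := by
    intro d
    induction d with
    | zero => intro r hr; rw [hT r (by simpa using hr)]; exact zero_mem _
    | succ d ih =>
      intro r hr
      exact step r fun r' hr' => ih r' (by push_cast at hr; omega)
  exact mem_nilradical.1 (all (T - r).toNat r (by omega))

/-! ### The associated graded space and symbols of operators -/

/-- The sequences whose terms lie in the steps of a filtration. -/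
def reesSubmodule {W : Type*} [AddCommGroup W] [Module ℂ W] (F : ℤ → Submodule ℂ W) :
    Submodule ℂ (ℤ → W) :=
  Submodule.pi Set.univ F

section Graded

variable {W : Type*} [AddCommGroup W] [Module ℂ W] (F : ℤ → Submodule ℂ W)

/-- The associated graded space of a filtration. -/
abbrev AssocGraded : Type _ :=
  reesSubmodule F ⧸ (reesSubmodule fun p => F (p - 1)).comap (reesSubmodule F).subtype

/-- The operator on sequences that applies `T` to each term and shifts the degree by `q`. -/
def shiftEnd (q : ℤ) (T : Module.End ℂ W) : Module.End ℂ (ℤ → W) :=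
  LinearMap.pi fun p => T ∘ₗ LinearMap.proj (p - q)

variable {F} in
theorem shiftEnd_mem {q : ℤ} {T : Module.End ℂ W} (hT : T ∈ opFilt F q) :
    ∀ f ∈ reesSubmodule F, shiftEnd q T f ∈ reesSubmodule F :=
  fun _ hf p _ => opFilt_apply_mem hT (hf (p - q) trivial) (by ring)

variable {F} in
theorem shiftEnd_mem' {q : ℤ} {T : Module.End ℂ W} (hT : T ∈ opFilt F q) :
    ∀ f ∈ reesSubmodule fun p => F (p - 1), shiftEnd q T f ∈ reesSubmodule fun p => F (p - 1) :=
  fun _ hf p _ => opFilt_apply_mem hT (hf (p - q) trivial) (by ring)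

open Classical in
/-- The operator on the associated graded space induced by an operator of degree `q`. -/
def symb (q : ℤ) (T : Module.End ℂ W) : Module.End ℂ (AssocGraded F) :=
  -- The default value makes the symbol total, so that it can be named without a degree bound; the
  -- calculation rules supply the bound.
  if hT : T ∈ opFilt F q then
    Submodule.mapQ _ _ ((shiftEnd q T).restrict (shiftEnd_mem hT))
      fun f hf => shiftEnd_mem' hT f.1 hf
  else 0

variable {F}

theorem symb_mk {q : ℤ} {T : Module.End ℂ W} (hT : T ∈ opFilt F q) (f : reesSubmodule F) :
    symb F q T (Submodule.Quotient.mk f) =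
      Submodule.Quotient.mk ⟨shiftEnd q T f, shiftEnd_mem hT f f.2⟩ := by
  rw [symb, dif_pos hT]
  rfl

theorem symb_ext {X Y : Module.End ℂ (AssocGraded F)}
    (h : ∀ f : reesSubmodule F, X (Submodule.Quotient.mk f) = Y (Submodule.Quotient.mk f)) :
    X = Y :=
  LinearMap.ext fun z => by
    obtain ⟨f, rfl⟩ := Submodule.Quotient.mk_surjective _ z
    exact h f

theorem symb_mul {a b : ℤ} {S T : Module.End ℂ W} (hS : S ∈ opFilt F a) (hT : T ∈ opFilt F b) :
    symb F a S * symb F b T = symb F (a + b) (S * T) := by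
  refine symb_ext fun f => ?_
  rw [Module.End.mul_apply, symb_mk hT, symb_mk hS, symb_mk (opFilt_mul_mem hS hT)]
  congr 2
  funext p
  simp [shiftEnd, sub_sub]

theorem symb_one : symb F 0 1 = 1 := by
  refine symb_ext fun f => ?_
  rw [symb_mk opFilt_one_mem, Module.End.one_apply]
  congr 2
  funext p
  simp [shiftEnd]

theorem symb_add {q : ℤ} {S T : Module.End ℂ W} (hS : S ∈ opFilt F q) (hT : T ∈ opFilt F q) :
    symb F q (S + T) = symb F q S + symb F q T := by
  refine symb_ext fun f => ?_
  rw [LinearMap.add_apply, symb_mk hT, symb_mk hS, symb_mk (add_mem hS hT)]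
  rfl

theorem symb_zero {q : ℤ} : symb F q 0 = 0 := by
  have h := symb_add (zero_mem (opFilt F q)) (zero_mem (opFilt F q))
  rwa [add_zero, left_eq_add] at h

theorem symb_sum {q : ℤ} {ι : Type*} (t : Finset ι) {T : ι → Module.End ℂ W}
    (hT : ∀ i ∈ t, T i ∈ opFilt F q) : symb F q (∑ i ∈ t, T i) = ∑ i ∈ t, symb F q (T i) := by
  classical
  induction t using Finset.induction_on with
  | empty => simp [symb_zero]
  | insert i t hi ih =>
    rw [Finset.sum_insert hi, Finset.sum_insert hi, symb_add (hT i (Finset.mem_insert_self i t))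
      (sum_mem fun j hj => hT j (Finset.mem_insert_of_mem hj)),
      ih fun j hj => hT j (Finset.mem_insert_of_mem hj)]

theorem symb_pow {q : ℤ} {T : Module.End ℂ W} (hT : T ∈ opFilt F q) (n : ℕ) :
    symb F q T ^ n = symb F (n * q) (T ^ n) := by
  induction n with
  | zero => simp [symb_one]
  | succ n ih =>
    rw [pow_succ, ih, symb_mul (opFilt_pow_mem hT n) hT, pow_succ]
    congr 1
    push_cast
    ring

/-- Sequences with a single nonzero entry detect the degree of `T`, so vanishing of the symbol is
exactly a drop in degree. -/
theorem symb_eq_zero_iff {q : ℤ} {T : Module.End ℂ W} (hT : T ∈ opFilt F q) :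
    symb F q T = 0 ↔ T ∈ opFilt F (q - 1) := by
  constructor
  · intro h p w hw
    let f : reesSubmodule F := ⟨Pi.single p w, fun p' _ => by
      rcases eq_or_ne p' p with rfl | hne
      · simpa using hw
      · simp [hne]⟩
    have h1 := symb_mk hT f
    rw [h, LinearMap.zero_apply, eq_comm, Submodule.Quotient.mk_eq_zero] at h1
    have h2 := h1 (p + q) trivial
    rw [show p + (q - 1) = p + q - 1 by ring]
    simpa [shiftEnd, f] using h2
  · intro h
    refine symb_ext fun f => ?_
    rw [symb_mk hT, LinearMap.zero_apply, Submodule.Quotient.mk_eq_zero]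
    exact fun p _ => opFilt_apply_mem h (f.2 (p - q) trivial) (by ring)

theorem symb_eq_of_sub_mem {q : ℤ} {S T : Module.End ℂ W} (hT : T ∈ opFilt F q)
    (hF : Monotone F) (h : S - T ∈ opFilt F (q - 1)) : symb F q S = symb F q T := by
  have h' : S - T ∈ opFilt F q := opFilt_mono hF (by omega) h
  have h1 := symb_add h' hT
  rwa [sub_add_cancel, (symb_eq_zero_iff h').2 h, zero_add] at h1

end Graded

/-! ### Commutativity and nilpotency of the symbols of modes -/

namespace VertexOperatorAlgebra

variable {V : Type*} [AddCommGroup V] [Module ℂ V] {A : VertexOperatorAlgebra V}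

namespace WeakTwistedModule

variable {g : A.Automorphism} {W : Type*} [AddCommGroup W] [Module ℂ W]
  (M : A.WeakTwistedModule g W) (s : Set W)

/-- The algebra of operators on the associated graded space generated by the modes. -/
def modeAlgebra : Subalgebra ℂ (Module.End ℂ (AssocGraded (M.filt s))) :=
  Algebra.adjoin ℂ {X | ∃ (q : ℤ) (u : V) (n : ℂ), u ∈ A.weightSpace q ∧
    X = symb (M.filt s) q (M.mode u n 0)}

variable {M s}

/-- The generators commute because commutators of modes lose one degree. -/
theorem isMulCommutative_modeAlgebra (hCFT : A.IsCFTType) :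
    IsMulCommutative (M.modeAlgebra s) := by
  refine Algebra.isMulCommutative_adjoin _ ?_
  rintro _ ⟨a, u, m, hu, rfl⟩ _ ⟨b, v, n, hv, rfl⟩
  have hu' := mode_mem_opFilt (M := M) (s := s) hCFT hu m
  have hv' := mode_mem_opFilt (M := M) (s := s) hCFT hv n
  rw [symb_mul hu' hv', symb_mul hv' hu', add_comm b a]
  refine symb_eq_of_sub_mem ?_ filt_mono (commutator_mem_opFilt hCFT hu hv m n)
  rw [add_comm]
  exact opFilt_mul_mem hv' hu'

theorem symb_mem_modeAlgebra {q : ℤ} {u : V} (hu : u ∈ A.weightSpace q) (n : ℂ) :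
    symb (M.filt s) q (M.mode u n 0) ∈ M.modeAlgebra s :=
  Algebra.subset_adjoin ⟨q, u, n, hu, rfl⟩

theorem symb_mode_neg_one (hCFT : A.IsCFTType) {a b : ℤ} {μ : ℂ} {u v : V}
    (hu : u ∈ A.weightSpace a) (hμ : u ∈ g.genSpace μ) (hv : v ∈ A.weightSpace b) {r : ℤ} {m : ℂ}
    (hm : m = twistExponent μ + r) (n : ℂ) {I : ℕ}
    (hIu : ∀ i : ℕ, I ≤ i → M.mode u (m + i) 0 ∈ opFilt (M.filt s) (a - 1))
    (hIv : ∀ i : ℕ, I ≤ i → M.mode v (n + i) 0 ∈ opFilt (M.filt s) (b - 1)) :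
    symb (M.filt s) (a + b) (M.mode (A.mode u (-1) v) (m + n) 0) =
      ∑ i ∈ Finset.range I, symb (M.filt s) a (M.mode u (m - 1 - i) 0) *
        symb (M.filt s) b (M.mode v (n + i) 0) +
      ∑ i ∈ Finset.range I, symb (M.filt s) b (M.mode v (n - 1 - i) 0) *
        symb (M.filt s) a (M.mode u (m + i) 0) := by
  have h1 (m n : ℂ) : M.mode u m 0 * M.mode v n 0 ∈ opFilt (M.filt s) (a + b) :=
    opFilt_mul_mem (mode_mem_opFilt hCFT hu m) (mode_mem_opFilt hCFT hv n)
  have h2 (m n : ℂ) : M.mode v n 0 * M.mode u m 0 ∈ opFilt (M.filt s) (a + b) := by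
    rw [add_comm]
    exact opFilt_mul_mem (mode_mem_opFilt hCFT hv n) (mode_mem_opFilt hCFT hu m)
  rw [symb_eq_of_sub_mem (add_mem (sum_mem fun i _ => h1 _ _) (sum_mem fun i _ => h2 _ _))
    filt_mono (mode_neg_one_sub_mem_opFilt hCFT hu hμ hv hm n hIu hIv),
    symb_add (sum_mem fun i _ => h1 _ _) (sum_mem fun i _ => h2 _ _),
    symb_sum _ fun i _ => h1 _ _, symb_sum _ fun i _ => h2 _ _]
  congr 1
  · exact Finset.sum_congr rfl fun i _ =>
      (symb_mul (mode_mem_opFilt hCFT hu _) (mode_mem_opFilt hCFT hv _)).symm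
  · refine Finset.sum_congr rfl fun i _ => ?_
    rw [symb_mul (mode_mem_opFilt hCFT hv _) (mode_mem_opFilt hCFT hu _), add_comm b a]

theorem mode_neg_one_pow_vac_mem {a : ℤ} {u : V} (hu : u ∈ A.weightSpace a) (j : ℕ) :
    (A.mode u (-1) ^ j) A.vac ∈ A.weightSpace (j * a) := by
  induction j with
  | zero => simpa using vac_mem_weightSpace
  | succ j ih =>
    rw [pow_succ', Module.End.mul_apply]
    have := mode_mem_weightSpace hu ih (-1)
    rwa [show a + j * a - -1 - 1 = ((j + 1 : ℕ) : ℤ) * a by push_cast; ring] at this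

/-- Each mode of positive weight acts nilpotently on the associated graded space. -/
theorem exists_pow_mode_mem_opFilt (hCFT : A.IsCFTType) (hC2 : A.IsC2Cofinite) (hs : s.Finite)
    {a : ℤ} (ha : 1 ≤ a) {μ : ℂ} {u : V} (hu : u ∈ A.weightSpace a) (hμ : u ∈ g.genSpace μ)
    (r : ℤ) {m : ℂ} (hm : m = twistExponent μ + r) :
    ∃ N : ℕ, M.mode u m 0 ^ N ∈ opFilt (M.filt s) (N * a - 1) := by
  have := isMulCommutative_modeAlgebra (M := M) (s := s) hCFT
  let v (j : ℕ) : V := (A.mode u (-1) ^ j) A.vac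
  have hv (j : ℕ) : v j ∈ A.weightSpace (j * a) := mode_neg_one_pow_vac_mem hu j
  let x (r : ℤ) : M.modeAlgebra s := ⟨_, symb_mem_modeAlgebra hu (twistExponent μ + r)⟩
  -- The shift `j - 1` absorbs the offset in the index of each product `u(-1)v`; for `j = 0` it
  -- places the identity mode of the vacuum at `t = 0`.
  let y (j : ℕ) (t : ℤ) : M.modeAlgebra s :=
    ⟨_, symb_mem_modeAlgebra (hv j) (j * twistExponent μ + t + (j - 1))⟩
  have hnil : IsNilpotent (x r) := by
    refine isNilpotent_of_convolution x y ?_ ?_ ?_ ?_ ?_ r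
    · refine Subtype.ext ?_
      have h1 : M.mode (v 0) ((0 : ℕ) * twistExponent μ + (0 : ℤ) + ((0 : ℕ) - 1)) 0 = 1 := by
        ext w
        exact (M.identity _ _ _).trans (if_pos (by simp))
      simp only [y]
      rw [h1]
      simp [symb_one]
    · intro t ht
      refine Subtype.ext ?_
      have h1 : M.mode (v 0) ((0 : ℕ) * twistExponent μ + t + ((0 : ℕ) - 1)) 0 = 0 := by
        ext w
        exact (M.identity _ _ _).trans (if_neg (by simpa using ht))
      simp only [y, h1, symb_zero, ZeroMemClass.coe_zero]
    · obtain ⟨N, hN⟩ := exists_mode_mem_opFilt (M := M) hCFT hs hu (twistExponent μ)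
      exact ⟨N, fun r hr => Subtype.ext
        ((symb_eq_zero_iff (mode_mem_opFilt hCFT hu _)).2 (hN r hr))⟩
    · intro j r t
      obtain ⟨N₁, hN₁⟩ := exists_mode_mem_opFilt (M := M) hCFT hs hu (twistExponent μ + (r + 1 : ℤ))
      obtain ⟨N₂, hN₂⟩ := exists_mode_mem_opFilt (M := M) hCFT hs (hv j)
        (j * twistExponent μ + t + (j - 1))
      refine ⟨max N₁.toNat N₂.toNat, Subtype.ext ?_⟩
      have h := symb_mode_neg_one hCFT hu hμ (hv j) (r := r + 1) rfl
        (j * twistExponent μ + t + (j - 1)) (I := max N₁.toNat N₂.toNat + 1)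
        (fun i hi => by simpa using hN₁ i (by omega)) (fun i hi => by simpa using hN₂ i (by omega))
      simp only [x, y, AddMemClass.coe_add, AddSubmonoidClass.coe_finsetSum, MulMemClass.coe_mul]
      have e : v (j + 1) = A.mode u (-1) (v j) := by
        simp only [v, pow_succ', Module.End.mul_apply]
      rw [e]
      convert h using 1
      · congr 2
        · push_cast; ring
        · push_cast; ring_nf
      · congr 1
        · refine Finset.sum_congr rfl fun i _ => ?_
          congr 3 <;> push_cast <;> ring_nf
        · refine Finset.sum_congr rfl fun i _ => ?_
          congr 3 <;> push_cast <;> ring_nf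
    · obtain ⟨q₀, hq₀⟩ := g.exists_weightSpace_le_homC2 hC2
      -- As `a ≥ 1`, the vector `u(-1)^Q 1` has weight `Q * a ≥ q₀` for this `Q`, so it lies in
      -- `C₂(V)` and its modes have zero symbol.
      refine ⟨q₀.toNat, fun t => Subtype.ext ?_⟩
      refine (symb_eq_zero_iff (mode_mem_opFilt hCFT (hv _) _)).2
        (mode_mem_opFilt_of_homC2 hCFT (hq₀ _ ?_ (hv _)) _)
      have := Int.self_le_toNat q₀
      nlinarith
  obtain ⟨N, hN⟩ := hnil
  refine ⟨N, ?_⟩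
  have hu' := mode_mem_opFilt (M := M) (s := s) hCFT hu m
  rw [← symb_eq_zero_iff (opFilt_pow_mem hu' N), ← symb_pow hu', hm]
  exact congrArg Subtype.val hN

end WeakTwistedModule
end VertexOperatorAlgebra

/-! ### Words in finitely many modes and cofiniteness -/

namespace VertexOperatorAlgebra

variable {V : Type*} [AddCommGroup V] [Module ℂ V] {A : VertexOperatorAlgebra V}

namespace WeakTwistedModule

variable {g : A.Automorphism} {W : Type*} [AddCommGroup W] [Module ℂ W]
  {M : A.WeakTwistedModule g W} {s : Set W}

section Words

variable {ι : Type*} {wt : ι → ℤ} {vec : ι → V} {idx : ι → ℂ}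

theorem word_mem_opFilt (hCFT : A.IsCFTType) (hvec : ∀ i, vec i ∈ A.weightSpace (wt i))
    (l : List ι) :
    (l.map fun i => M.mode (vec i) (idx i) 0).prod ∈ opFilt (M.filt s) (l.map wt).sum := by
  induction l with
  | nil => simpa using opFilt_one_mem
  | cons i l ih =>
    simp only [List.map_cons, List.prod_cons, List.sum_cons]
    exact opFilt_mul_mem (mode_mem_opFilt hCFT (hvec i) _) ih

theorem symb_word (hCFT : A.IsCFTType) (hvec : ∀ i, vec i ∈ A.weightSpace (wt i)) (l : List ι) :
    symb (M.filt s) (l.map wt).sum (l.map fun i => M.mode (vec i) (idx i) 0).prod =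
      (l.map fun i => symb (M.filt s) (wt i) (M.mode (vec i) (idx i) 0)).prod := by
  induction l with
  | nil => simpa using symb_one
  | cons i l ih =>
    simp only [List.map_cons, List.prod_cons, List.sum_cons]
    rw [← ih, symb_mul (mode_mem_opFilt hCFT (hvec i) _) (word_mem_opFilt hCFT hvec l)]

/-- A product of modes in which one mode occurs often has smaller degree than its weight. -/
theorem word_mem_opFilt_of_le_count [DecidableEq ι] (hCFT : A.IsCFTType)
    (hvec : ∀ i, vec i ∈ A.weightSpace (wt i)) (l : List ι) {i : ι} {N : ℕ}
    (hN : M.mode (vec i) (idx i) 0 ^ N ∈ opFilt (M.filt s) (N * wt i - 1)) (hi : i ∈ l)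
    (hl : N ≤ l.count i) :
    (l.map fun i => M.mode (vec i) (idx i) 0).prod ∈
      opFilt (M.filt s) ((l.map wt).sum - 1) := by
  have := isMulCommutative_modeAlgebra (M := M) (s := s) hCFT
  rw [← symb_eq_zero_iff (word_mem_opFilt hCFT hvec l), symb_word hCFT hvec]
  let f (i : ι) : M.modeAlgebra s := ⟨_, symb_mem_modeAlgebra (hvec i) (idx i)⟩
  have hf : f i ^ N = 0 := by
    refine Subtype.ext ?_
    have hu := mode_mem_opFilt (M := M) (s := s) hCFT (hvec i) (idx i)
    rw [← symb_eq_zero_iff (opFilt_pow_mem hu N), ← symb_pow hu] at hN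
    exact hN
  have h0 : (l.map f).prod = 0 := by
    -- In the commutative algebra the word can be regrouped by multiplicities, which exposes the
    -- vanishing power.
    rw [Finset.prod_list_map_count]
    refine Finset.prod_eq_zero (List.mem_toFinset.2 hi) ?_
    rw [← Nat.add_sub_cancel' hl, pow_add, hf, zero_mul]
  have h1 := congrArg (M.modeAlgebra s).val h0
  rw [map_list_prod, List.map_map, map_zero] at h1
  exact h1

variable (M s wt vec idx) in
/-- The span of the products of modes from a given family, of total weight `p`, applied to
generators. -/
def wordSpan (p : ℤ) : Submodule ℂ W :=
  Submodule.span ℂ {x | ∃ (l : List ι) (y : W), (l.map wt).sum = p ∧ y ∈ s ∧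
    x = (l.map fun i => M.mode (vec i) (idx i) 0).prod y}

theorem length_le_sum_of_one_le (hwt : ∀ i, 1 ≤ wt i) (l : List ι) :
    (l.length : ℤ) ≤ (l.map wt).sum := by
  induction l with
  | nil => simp
  | cons i l ih =>
    rw [List.length_cons, List.map_cons, List.sum_cons]
    have := hwt i
    push_cast
    omega

theorem finiteDimensional_wordSpan [Finite ι] (hwt : ∀ i, 1 ≤ wt i) (hs : s.Finite) (p : ℤ) :
    FiniteDimensional ℂ (M.wordSpan s wt vec idx p) := by
  refine FiniteDimensional.span_of_finite ℂ ?_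
  refine (((List.finite_length_le ι p.toNat).prod hs).image fun x =>
    (x.1.map fun i => M.mode (vec i) (idx i) 0).prod x.2).subset ?_
  rintro _ ⟨l, y, hl, hy, rfl⟩
  refine ⟨(l, y), ⟨?_, hy⟩, rfl⟩
  have := length_le_sum_of_one_le hwt l
  change l.length ≤ p.toNat
  omega

/-- Pigeonhole: a word in which every mode `i` that occurs does so fewer than `N i` times has weight
at most `∑ N i * wt i`. A heavier word contains a nilpotent power and loses degree. -/
theorem exists_wordSpan_le_filt [Finite ι] (hCFT : A.IsCFTType)
    (hvec : ∀ i, vec i ∈ A.weightSpace (wt i)) (hwt : ∀ i, 1 ≤ wt i)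
    (hnil : ∀ i, ∃ N : ℕ, M.mode (vec i) (idx i) 0 ^ N ∈ opFilt (M.filt s) (N * wt i - 1)) :
    ∃ p₀ : ℤ, ∀ p, p₀ < p → M.wordSpan s wt vec idx p ≤ M.filt s (p - 1) := by
  classical
  have := Fintype.ofFinite ι
  choose N hN using hnil
  refine ⟨∑ i, N i * wt i, fun p hp => Submodule.span_le.2 ?_⟩
  rintro _ ⟨l, y, hl, hy, rfl⟩
  have h : ∃ i ∈ l, N i ≤ l.count i := by
    by_contra! h
    rw [Finset.sum_list_map_count] at hl
    have h1 : ∑ i ∈ l.toFinset, l.count i • wt i ≤ ∑ i ∈ l.toFinset, N i * wt i := by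
      refine Finset.sum_le_sum fun i hi => ?_
      rw [nsmul_eq_mul]
      have := h i (List.mem_toFinset.1 hi)
      have := hwt i
      gcongr
    have h2 : ∑ i ∈ l.toFinset, N i * wt i ≤ ∑ i, N i * wt i :=
      Finset.sum_le_sum_of_subset_of_nonneg (Finset.subset_univ _) fun i _ _ =>
        mul_nonneg (by positivity) (zero_le_one.trans (hwt i))
    omega
  obtain ⟨i, hi, hle⟩ := h
  exact opFilt_apply_mem (word_mem_opFilt_of_le_count hCFT hvec l (hN i) hi hle)
    (IsMonomial.base hy).mem_filt (by rw [hl]; ring)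

theorem mode_mem_wordSpan (i : ι) {p : ℤ} {w : W} (hw : w ∈ M.wordSpan s wt vec idx p) :
    M.mode (vec i) (idx i) 0 w ∈ M.wordSpan s wt vec idx (p + wt i) := by
  have hle : M.wordSpan s wt vec idx p ≤
      (M.wordSpan s wt vec idx (p + wt i)).comap (M.mode (vec i) (idx i) 0) := by
    refine Submodule.span_le.2 ?_
    rintro _ ⟨l, y, hl, hy, rfl⟩
    refine Submodule.subset_span ⟨i :: l, y, ?_, hy, ?_⟩
    · rw [List.map_cons, List.sum_cons, hl, add_comm]
    · rw [List.map_cons, List.prod_cons, Module.End.mul_apply]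
  exact hle hw

end Words

theorem exists_finite_span_eq_weightSpace (g : A.Automorphism) (a : ℤ) :
    ∃ t : Set V, t.Finite ∧ A.weightSpace a = Submodule.span ℂ t ∧
      ∀ u ∈ t, u ∈ A.weightSpace a ∧ ∃ μ, u ∈ g.genSpace μ := by
  have hspan : Submodule.span ℂ {u | u ∈ A.weightSpace a ∧ ∃ μ, u ∈ g.genSpace μ} =
      A.weightSpace a := by
    refine le_antisymm (Submodule.span_le.2 fun u hu => hu.1) fun u hu => ?_
    exact g.weightSpace_induction (p := (· ∈ Submodule.span ℂ
      {u | u ∈ A.weightSpace a ∧ ∃ μ, u ∈ g.genSpace μ}))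
      (fun μ u hu hμ => Submodule.subset_span ⟨hu, μ, hμ⟩)
      (zero_mem _) (fun _ _ hx hy => add_mem hx hy) hu
  have hfg : (A.weightSpace a).FG :=
    (Submodule.fg_iff_finiteDimensional _).2 (A.finite_weight a)
  rw [← hspan, Submodule.fg_span_iff_fg_span_finset_subset] at hfg
  obtain ⟨t, ht, hspan'⟩ := hfg
  exact ⟨t, t.finite_toSet, hspan ▸ hspan', fun u hu => ht hu⟩

/-- Indices outside the coset of the twist exponent give zero modes, large ones lower the degree,
and those at most `α - n` are of the excluded form. What remains is an interval of integers shifted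
by `α`. -/
theorem finite_setOf_mode_notMem (hCFT : A.IsCFTType) (hs : s.Finite) (n : ℕ) {a : ℤ} {μ : ℂ}
    {u : V} (hu : u ∈ A.weightSpace a) (hμ : u ∈ g.genSpace μ) :
    {m : ℂ | M.mode u m 0 ∉ opFilt (M.filt s) (a - 1) ∧
      ¬ ∃ (k : ℕ) (ν : ℂ), n ≤ k ∧ u ∈ g.genSpace ν ∧ m = twistExponent ν - k}.Finite := by
  obtain ⟨N, hN⟩ := exists_mode_mem_opFilt (M := M) hCFT hs hu (twistExponent μ)
  refine ((Set.finite_Ioo (-(n : ℤ)) N).image fun r : ℤ => twistExponent μ + r).subset ?_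
  rintro m ⟨h1, h2⟩
  by_cases hr : ∃ r : ℤ, m = twistExponent μ + r
  · obtain ⟨r, rfl⟩ := hr
    refine ⟨r, ⟨?_, ?_⟩, rfl⟩
    · by_contra hlt
      refine h2 ⟨(-r).toNat, μ, by omega, hμ, ?_⟩
      have h3 : (((-r).toNat : ℤ) : ℂ) = ((-r : ℤ) : ℂ) := by
        rw [Int.toNat_of_nonneg (by omega)]
      rw [Int.cast_natCast] at h3
      rw [h3]
      push_cast
      ring
    · by_contra hle
      exact h1 (hN r (not_lt.1 hle))
  · push Not at hr
    refine absurd ?_ h1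
    have h0 : M.mode u m 0 = 0 := LinearMap.ext fun w => M.mode_eq_zero hμ hr 0 w
    rw [h0]
    exact zero_mem _

/-- Finitely many modes suffice, up to modes that lower the degree and modes with image in
`C_n(W)`. -/
theorem exists_finite_modes (hCFT : A.IsCFTType) (hC2 : A.IsC2Cofinite) (hs : s.Finite) (n : ℕ) :
    ∃ X : Set (ℤ × V × ℂ), X.Finite ∧
      (∀ x ∈ X, 1 ≤ x.1 ∧ x.2.1 ∈ A.weightSpace x.1 ∧
        ∃ N : ℕ, M.mode x.2.1 x.2.2 0 ^ N ∈ opFilt (M.filt s) (N * x.1 - 1)) ∧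
      ∀ a, 1 ≤ a → ∃ t : Set V, A.weightSpace a = Submodule.span ℂ t ∧ ∀ u ∈ t, ∀ m : ℂ,
        (a, u, m) ∈ X ∨ M.mode u m 0 ∈ opFilt (M.filt s) (a - 1) ∨
          ∃ (k : ℕ) (ν : ℂ), n ≤ k ∧ u ∈ g.genSpace ν ∧ m = twistExponent ν - k := by
  obtain ⟨q₀, hq₀⟩ := g.exists_weightSpace_le_homC2 hC2
  choose t htfin htspan ht using exists_finite_span_eq_weightSpace g
  let R (a : ℤ) (u : V) : Set ℂ := {m : ℂ | M.mode u m 0 ∉ opFilt (M.filt s) (a - 1) ∧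
      ¬ ∃ (k : ℕ) (ν : ℂ), n ≤ k ∧ u ∈ g.genSpace ν ∧ m = twistExponent ν - k}
  have hR : ∀ a, ∀ u ∈ t a, (R a u).Finite := fun a u hu => by
    obtain ⟨hu, μ, hμ⟩ := ht a u hu
    exact finite_setOf_mode_notMem hCFT hs n hu hμ
  -- Weights from `q₀` on contribute nothing, since there every vector lies in `C₂(V)` and its modes
  -- lower the degree.
  refine ⟨⋃ a ∈ Set.Ico 1 q₀, ⋃ u ∈ t a, (fun m => (a, u, m)) '' R a u, ?_, ?_, ?_⟩
  · exact (Set.finite_Ico 1 q₀).biUnion fun a _ => (htfin a).biUnion fun u hu => (hR a u hu).image _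
  · intro x hx
    simp only [Set.mem_iUnion] at hx
    obtain ⟨a, ha, u, hu, m, hm, rfl⟩ := hx
    obtain ⟨hu, μ, hμ⟩ := ht a u hu
    refine ⟨ha.1, hu, ?_⟩
    by_cases hr : ∃ r : ℤ, m = twistExponent μ + r
    · obtain ⟨r, hr⟩ := hr
      exact exists_pow_mode_mem_opFilt hCFT hC2 hs ha.1 hu hμ r hr
    · push Not at hr
      have h0 : M.mode u m 0 = 0 := LinearMap.ext fun w => M.mode_eq_zero hμ hr 0 w
      exact absurd (h0 ▸ zero_mem _) hm.1
  · intro a ha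
    refine ⟨t a, htspan a, fun u hu m => ?_⟩
    by_cases hq : a < q₀
    · by_cases hm : m ∈ R a u
      · left
        simp only [Set.mem_iUnion]
        exact ⟨a, ⟨ha, hq⟩, u, hu, m, hm, rfl⟩
      · right
        by_contra! h
        exact hm ⟨h.1, by push Not; exact h.2⟩
    · exact Or.inr (Or.inl (mode_mem_opFilt_of_homC2 hCFT (hq₀ a (by omega) (ht a u hu).1) m))

/-- Build up a monomial one mode at a time. A mode from `X` extends words and respects the other two
summands; any other mode lowers the degree or lands in `filtC` directly. -/
theorem filt_le_sup {X : Set (ℤ × V × ℂ)} (hCFT : A.IsCFTType) {n : ℕ}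
    (h : ∀ a, 1 ≤ a → ∃ t : Set V, A.weightSpace a = Submodule.span ℂ t ∧ ∀ u ∈ t, ∀ m : ℂ,
        (a, u, m) ∈ X ∨ M.mode u m 0 ∈ opFilt (M.filt s) (a - 1) ∨
          ∃ (k : ℕ) (ν : ℂ), n ≤ k ∧ u ∈ g.genSpace ν ∧ m = twistExponent ν - k) (p : ℤ) :
    M.filt s p ≤ M.filt s (p - 1) ⊔ M.filtC s n p ⊔
      M.wordSpan s (fun x : X => x.1.1) (fun x => x.1.2.1) (fun x => x.1.2.2) p := by
  have key : ∀ p w, M.IsMonomial s p w → w ∈ M.filt s (p - 1) ⊔ M.filtC s n p ⊔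
      M.wordSpan s (fun x : X => x.1.1) (fun x => x.1.2.1) (fun x => x.1.2.2) p := by
    intro p w hw
    induction hw with
    | @base x hx =>
      exact Submodule.mem_sup_right (Submodule.subset_span ⟨[], x, by simp, hx, by simp⟩)
    | @step p q u w m hq hu hw ih =>
      obtain ⟨t, ht, hall⟩ := h q hq
      have hu' : u ∈ Submodule.span ℂ t := ht ▸ hu
      clear hu
      induction hu' using Submodule.span_induction with
      | zero => rw [mode_zero]; exact zero_mem _
      | add x y _ _ hx hy => rw [mode_add]; exact add_mem hx hy
      | smul c x _ hx => rw [mode_smul]; exact Submodule.smul_mem _ c hx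
      | mem u hut =>
        have hu : u ∈ A.weightSpace q := ht ▸ Submodule.subset_span hut
        rcases hall u hut m with hmem | hnull | ⟨k, ν, hk, hν, rfl⟩
        · obtain ⟨w', hw', e, he, rfl⟩ := Submodule.mem_sup.1 ih
          obtain ⟨f, hf, c, hc, rfl⟩ := Submodule.mem_sup.1 hw'
          rw [map_add, map_add]
          refine add_mem (Submodule.mem_sup_left (add_mem (Submodule.mem_sup_left ?_) ?_))
            (Submodule.mem_sup_right (mode_mem_wordSpan (⟨_, hmem⟩ : X) he))
          · exact opFilt_apply_mem (mode_mem_opFilt hCFT hu m) hf (by ring)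
          · exact mode_mem_filtC_sup hCFT hu m hc
        · refine Submodule.mem_sup_left (Submodule.mem_sup_left ?_)
          exact opFilt_apply_mem hnull hw.mem_filt (by ring)
        · refine Submodule.mem_sup_left (Submodule.mem_sup_right (Submodule.subset_span
            ⟨k, q, ν, u, w, hk, by omega, hu, hν, ?_, rfl⟩))
          rw [add_sub_cancel_right]
          exact hw.mem_filt
  refine Submodule.span_le.2 ?_
  rintro w ⟨p', hp', hw⟩
  rcases hp'.lt_or_eq with hlt | rfl
  · exact Submodule.mem_sup_left (Submodule.mem_sup_left (filt_mono (by omega) hw.mem_filt))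
  · exact key _ _ hw

/-- A finitely generated weak twisted module for a `C₂`-cofinite vertex operator algebra of CFT
type is `C_n`-cofinite. -/
theorem IsFinitelyGenerated.isCofinite (hC2 : A.IsC2Cofinite) (hCFT : A.IsCFTType)
    (hfg : M.IsFinitelyGenerated) {n : ℕ} (hn : 0 < n) : M.IsCofinite n := by
  obtain ⟨s, hs⟩ := hfg
  obtain ⟨X, hXfin, hX, hcover⟩ :=
    exists_finite_modes (M := M) (s := (s : Set W)) hCFT hC2 s.finite_toSet n
  have : Finite X := hXfin
  let E := M.wordSpan (s : Set W) (fun x : X => x.1.1) (fun x => x.1.2.1) (fun x => x.1.2.2)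
  have hE (p : ℤ) : FiniteDimensional ℂ (E p) :=
    finiteDimensional_wordSpan (fun x => (hX _ x.2).1) s.finite_toSet p
  obtain ⟨p₀, hp₀⟩ := exists_wordSpan_le_filt (M := M) (s := (s : Set W))
    (wt := fun x : X => x.1.1) (vec := fun x => x.1.2.1) (idx := fun x => x.1.2.2) hCFT
    (fun x => (hX _ x.2).2.1) (fun x => (hX _ x.2).1) (fun x => (hX _ x.2).2.2)
  let D : Submodule ℂ W := (Finset.Icc 0 p₀).sup E
  have hD : FiniteDimensional ℂ D := Submodule.finite_finset_sup _ _
  -- The shift by one starts the induction at degree `-1`, where the filtration is zero. Words of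
  -- weight at most `p₀` lie in `D`, and heavier ones drop to the previous degree.
  have hle : ∀ d : ℕ, M.filt (s : Set W) (d - 1) ≤ M.C n ⊔ D := by
    intro d
    induction d with
    | zero => rw [filt_of_neg (by simp)]; exact bot_le
    | succ d ih =>
      rw [Nat.cast_succ, add_sub_cancel_right]
      refine (filt_le_sup hCFT hcover d).trans
        (sup_le (sup_le ih ((filtC_le_C hn _).trans le_sup_left)) ?_)
      by_cases hd : (d : ℤ) ≤ p₀
      · exact le_sup_of_le_right
          (Finset.le_sup (f := E) (Finset.mem_Icc.2 ⟨Int.natCast_nonneg d, hd⟩))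
      · exact (hp₀ d (by omega)).trans ih
  have htop : M.C n ⊔ D = ⊤ := by
    refine eq_top_iff.2 fun w _ => ?_
    obtain ⟨p, hp⟩ := exists_mem_filt (M := M) hCFT (fun q hq => hs q hq) w
    exact hle (p + 1).toNat (filt_mono (by omega) hp)
  refine Module.Finite.of_surjective ((M.C n).mkQ ∘ₗ D.subtype) fun z => ?_
  obtain ⟨w, rfl⟩ := Submodule.mkQ_surjective _ z
  obtain ⟨c, hc, d, hd, rfl⟩ := Submodule.mem_sup.1 (htop ▸ Submodule.mem_top : w ∈ _)
  refine ⟨⟨d, hd⟩, ?_⟩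
  have h0 : (M.C n).mkQ c = 0 := (Submodule.Quotient.mk_eq_zero _).2 hc
  rw [map_add, h0, zero_add]
  rfl

end WeakTwistedModule
end VertexOperatorAlgebra

end

theorem mainTheorem1 {V W : Type*} [AddCommGroup V] [Module ℂ V] [AddCommGroup W] [Module ℂ W]
    (A : VertexOperatorAlgebra V) (hC2 : A.IsC2Cofinite) (hCFT : A.IsCFTType)
    (g : A.Automorphism) (M : A.WeakTwistedModule g W) (hfg : M.IsFinitelyGenerated)
    (n : ℕ) (hn : 0 < n) : M.IsCofinite n :=
  hfg.isCofinite hC2 hCFT hn
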